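/- Consider the Erlang A model ($M/M/m+M$ queue) with $m\ge 0$ servers, with time scaled so that the service rate is $\mu=1$: the queue length $(N(t))_{t\ge 0}$ is the birth--death process on $\{0,1,2,\dots\}$ with birth rate $\rho>0$ in every state and death rate $n$ in state $n\le m$, and $m+(n-m)\eta$ in state $n\ge m$, where $\eta>0$ is the abandonment rate. Let $p_n(t)=\mathbb{P}[N(t)=n\mid N(0)=n_0]$ (where $\mathbb P[N(0)=n_0]>0$) and, for $\operatorname{Re}\theta>0$, let $\widehat P_n(\theta)=\int_0^\infty e^{-\theta t}p_n(t)\,dt$. For integers $n\geq -1$ set $$F_n=\frac1{2\pi i}\int_{C_0}\frac{e^{\rho z}}{z^{n+1}(1-z)^{\theta}}\,dz,\quad H_n=\frac1{2\pi i}\int_{C_1}\frac{e^{\rho z/\eta}}{(z-1)^{\theta/\eta}z^{n+1-m}z^{m/\eta}}\,dz,\quad I_n=\frac1{2\pi i}\int_{C_2}\frac{e^{\rho z/\eta}}{(1-z)^{\theta/\eta}z^{n+1-m}z^{m/\eta}}\,dz,$$ where all complex powers are principal, $C_0$ is a counterclockwise circle around $0$ of radius less than $1$, and $C_1$, $C_2$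 run from $-\infty-i\varepsilon$ to $-\infty+i\varepsilon$ ($\varepsilon>0$) counterclockwise around $0$, with $C_1$ crossing the real axis once, to the right of $1$, and $C_2$ crossing it once, between $0$ and $1$. Theorem. Let $n_0\ge m$ and $\operatorname{Re}\theta>0$. Then the integrals $\widehat P_n(\theta)$ converge absolutely, $F_mH_{m-1}-H_mF_{m-1}\neq 0$, and $$\widehat P_n(\theta)=\frac1\rho e^{-\rho/\eta}\Big(\frac\eta\rho\Big)^{n_0-m-1+\frac{\theta+m}\eta}\Gamma\Big(\frac\theta\eta\Big)\Gamma\Big(n_0-m+1+\frac m\eta\Big)\Big[I_{n_0}+\frac{I_mF_{m-1}-I_{m-1}F_m}{F_mH_{m-1}-H_mF_{m-1}}H_{n_0}\Big]H_n,\quad n\ge n_0;$$ $$\widehat P_n(\theta)=\frac1\rho e^{-\rho/\eta}\Big(\frac\eta\rho\Big)^{n_0-m-1+\frac{\theta+m}\eta}\Gamma\Big(\frac\theta\eta\Big)\Gamma\Big(n_0-m+1+\frac m\eta\Big)\Big[I_{n}+\frac{I_mF_{m-1}-I_{m-1}F_m}{F_mH_{m-1}-H_mF_{m-1}}H_{n}\Big]H_{n_0},\quad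 m\le n\le n_0;$$ $$\widehat P_n(\theta)=\frac1\rho\Big(\frac\rho\eta\Big)^{m-n_0}\frac{\Gamma(n_0-m+1+\frac m\eta)}{\Gamma(1+\frac m\eta)}\,\frac{H_{n_0}F_n}{F_mH_{m-1}-H_mF_{m-1}},\quad 0\le n\le m.$$ -/

import Mathlib

open Filter Topology MeasureTheory

noncomputable section

/-- `P t i j` (for `t ≥ 0`) is the transition function of an honest birth-death process on `ℕ`
with birth rates `lam` and death rates `mu` (with `mu 0 = 0`): a stochastic semigroup with
`P h i (i+1) = lam i * h + o(h)`, `P h i (i-1) = mu i * h + o(h)` and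
`P h i i = 1 - (lam i + mu i) * h + o(h)` as `h ↓ 0`. Values at negative times are irrelevant. -/
structure IsBirthDeathTransition (lam mu : ℕ → ℝ) (P : ℝ → ℕ → ℕ → ℝ) : Prop where
  nonneg : ∀ t, 0 ≤ t → ∀ i j, 0 ≤ P t i j
  hasSum_one : ∀ t, 0 ≤ t → ∀ i, HasSum (fun j => P t i j) 1
  zero : ∀ i j, P 0 i j = if i = j then 1 else 0
  chapman_kolmogorov : ∀ s t, 0 ≤ s → 0 ≤ t → ∀ i j,
    HasSum (fun k => P s i k * P t k j) (P (s + t) i j)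
  birth : ∀ i, (fun h => P h i (i + 1) - lam i * h) =o[𝓝[>] 0] (fun h : ℝ => h)
  death : ∀ i, (fun h => P h (i + 1) i - mu (i + 1) * h) =o[𝓝[>] 0] (fun h : ℝ => h)
  stay : ∀ i, (fun h => P h i i - (1 - (lam i + mu i) * h)) =o[𝓝[>] 0] (fun h : ℝ => h)

/-- `(N t)`, `t ≥ 0`, is a birth-death process under `μ` with birth rates `lam` and death rates
`mu`: a time-homogeneous Markov chain in continuous time with state space `ℕ`, arbitrary initial
law, and a transition function with these rates. The Markov property is stated for the
probabilities of finite histories. -/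
structure IsBirthDeathProcess {Ω : Type*} [MeasurableSpace Ω] (lam mu : ℕ → ℝ)
    (μ : Measure Ω) (N : ℝ → Ω → ℕ) : Prop where
  measurable : ∀ t, 0 ≤ t → Measurable (N t)
  markov : ∃ P : ℝ → ℕ → ℕ → ℝ, IsBirthDeathTransition lam mu P ∧
    ∀ (k : ℕ) (t : ℕ → ℝ) (i : ℕ → ℕ), 0 ≤ t 0 → Monotone t →
      μ.real {ω | ∀ l ≤ k + 1, N (t l) ω = i l} =
        μ.real {ω | ∀ l ≤ k, N (t l) ω = i l} * P (t (k + 1) - t k) (i k) (i (k + 1))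

/-- Death rates of the Erlang A model with `m` servers, service rate `1` and abandonment
rate `η`: the rate is `n` for `n ≤ m` and `m + (n - m) η` for `n ≥ m`. -/
def erlangDeathRate (m : ℕ) (η : ℝ) (n : ℕ) : ℝ :=
  if n ≤ m then (n : ℝ) else (m : ℝ) + ((n : ℝ) - (m : ℝ)) * η

/-- The transition probability `p_n(t) = ℙ[N(t) = n ∣ N(0) = n₀]`. -/
def transientProb {Ω : Type*} [MeasurableSpace Ω] (μ : Measure Ω) (N : ℝ → Ω → ℕ)
    (n₀ n : ℕ) (t : ℝ) : ℝ :=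
  (ProbabilityTheory.cond μ (N 0 ⁻¹' {n₀})).real (N t ⁻¹' {n})

/-- The Laplace transform `∫₀^∞ e^{-θ t} p(t) dt`. -/
def laplaceTransform (p : ℝ → ℝ) (θ : ℂ) : ℂ :=
  ∫ t in Set.Ioi (0 : ℝ), Complex.exp (-θ * t) * (p t : ℂ)

/-- `∫_C f(z) dz` over the contour `C` that comes from `-∞ - iε` along `Im z = -ε` to `a - iε`,
goes up the segment `Re z = a` to `a + iε`, and returns along `Im z = ε` to `-∞ + iε`. -/
def loopIntegral (a ε : ℝ) (f : ℂ → ℂ) : ℂ :=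
  (∫ x in Set.Iic a, f (x - ε * Complex.I))
    + Complex.I * (∫ y in (-ε)..ε, f (a + y * Complex.I))
    - ∫ x in Set.Iic a, f (x + ε * Complex.I)

/-- `F_n(θ)`: integral over a circle around `0` inside the unit disc (any radius in `(0,1)` gives
the same value). Complex powers are principal, so `|arg(1 - z)| < π` on the contour. -/
def erlangF (ρ : ℝ) (θ : ℂ) (n : ℤ) : ℂ :=
  (2 * Real.pi * Complex.I)⁻¹ *
    ∮ z in C(0, 1 / 2), Complex.exp (ρ * z) / (z ^ (n + 1) * (1 - z) ^ θ)

/-- `H_n(θ; m)`: integral over a loop `C₁` from `-∞ - iε` to `-∞ + iε` around the cut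
`(-∞, 1]`, crossing the real axis to the right of `1`; all powers are principal. -/
def erlangH (ρ η : ℝ) (m : ℕ) (θ : ℂ) (n : ℤ) : ℂ :=
  (2 * Real.pi * Complex.I)⁻¹ *
    loopIntegral 2 2 (fun z => Complex.exp (ρ * z / η) /
      ((z - 1) ^ (θ / η) * z ^ (n + 1 - (m : ℤ)) * z ^ ((m : ℂ) / η)))

/-- `I_n(θ; m)`: integral over a loop `C₂` from `-∞ - iε` to `-∞ + iε` around the cut
`(-∞, 0]`, crossing the real axis between `0` and `1`; all powers are principal. -/
def erlangI (ρ η : ℝ) (m : ℕ) (θ : ℂ) (n : ℤ) : ℂ :=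
  (2 * Real.pi * Complex.I)⁻¹ *
    loopIntegral (1 / 2) 2 (fun z => Complex.exp (ρ * z / η) /
      ((1 - z) ^ (θ / η) * z ^ (n + 1 - (m : ℤ)) * z ^ ((m : ℂ) / η)))

/-- The denominator `F_m H_{m-1} - H_m F_{m-1}`. -/
def erlangD (ρ η : ℝ) (m : ℕ) (θ : ℂ) : ℂ :=
  erlangF ρ θ m * erlangH ρ η m θ (m - 1) - erlangH ρ η m θ m * erlangF ρ θ (m - 1)

end

/-! Fix the target state `n` and view the resolvent `R i`, the Laplace transform of `P t i n`, as a
function of the starting state. It solves the inhomogeneous backward equation with source at `i = n`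
and is bounded by `1 / Re θ`. A bounded solution of the homogeneous equation must vanish, since its
modulus would otherwise grow by a factor of at least `1 + Re θ / ρ` per step
(`eq_zero_of_bounded_backward`). Hence any bounded solution of the inhomogeneous equation is the
resolvent, and it remains to build one.

Multiplication by the reciprocal reversible weights turns solutions of the forward recursion into
solutions of the backward one. The solution is therefore a Green function (`eq_green_of_bounded`)
made of a forward solution `L` that vanishes at index `-1` and a forward solution `G` that stays
bounded after weighting. Up to state `m`, `L` is `F`; above `m` it is the combination of `I` and `H`
that continues `F`. From index `m - 1` on, `G` is `H`. The recursions for `F`, `H`, `I` hold because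
integrals of derivatives over the contours vanish. If `F_m H_{m-1} - H_m F_{m-1}` were zero, `G`
would satisfy the boundary condition at `-1` as well and would vanish by uniqueness.

The explicit constants come from the Casorati determinant of `I` and `H`
(`loopTransform_wronskian`). Unfolding the loops to vertical lines gives Euler integrals `∫ t^(α-1)
e^(-t) (κ+t)^(s-1) dt` over `(0,∞)` for `I` and `∫ u^(α-1) e^u (κ-u)^(s-1) du` over `(0,κ)` for `H`.
In the determinant the substitution `x = tu`, `q = (κ+t)(κ-u)` separates the double integral into
two Gamma integrals. The representation of `H` also gives the bound needed for `G`
(`exists_norm_loopTransform_le`). -/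

/-! ### The transition function, its backward equation and its resolvent. -/

namespace IsBirthDeathTransition

variable {lam mu : ℕ → ℝ} {P : ℝ → ℕ → ℕ → ℝ}

lemma le_one (hP : IsBirthDeathTransition lam mu P) {t : ℝ} (ht : 0 ≤ t) (i j : ℕ) :
    P t i j ≤ 1 := by
  have h := sum_le_hasSum {j} (fun k _ => hP.nonneg t ht i k) (hP.hasSum_one t ht i)
  simpa using h

lemma sum_le_add (hP : IsBirthDeathTransition lam mu P) {h t : ℝ} (hh : 0 ≤ h) (ht : 0 ≤ t)
    (i j : ℕ) (S : Finset ℕ) : ∑ k ∈ S, P h i k * P t k j ≤ P (h + t) i j :=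
  sum_le_hasSum S (fun k _ => mul_nonneg (hP.nonneg h hh i k) (hP.nonneg t ht k j))
    (hP.chapman_kolmogorov h t hh ht i j)

/-- Since `P t k j ≤ 1`, truncating the Chapman–Kolmogorov sum to `S` costs at most the mass that
lies outside `S` at time `h`. -/
lemma add_le_sum (hP : IsBirthDeathTransition lam mu P) {h t : ℝ} (hh : 0 ≤ h) (ht : 0 ≤ t)
    (i j : ℕ) (S : Finset ℕ) :
    P (h + t) i j ≤ ∑ k ∈ S, P h i k * P t k j + (1 - ∑ k ∈ S, P h i k) := by
  have key := sum_le_hasSum S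
    (fun k _ => sub_nonneg.2 (mul_le_of_le_one_right (hP.nonneg h hh i k) (hP.le_one ht k j)))
    ((hP.hasSum_one h hh i).sub (hP.chapman_kolmogorov h t hh ht i j))
  rw [Finset.sum_sub_distrib] at key
  linarith

lemma tendsto_stay (hP : IsBirthDeathTransition lam mu P) (i : ℕ) :
    Tendsto (fun h => P h i i) (𝓝[>] 0) (𝓝 1) := by
  have h0 : Tendsto (fun h : ℝ => h) (𝓝[>] 0) (𝓝 0) := tendsto_nhdsWithin_of_tendsto_nhds tendsto_id
  have h1 := ((hP.stay i).trans_tendsto h0).add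
    ((tendsto_const_nhds (x := (1 : ℝ))).sub (h0.const_mul (lam i + mu i)))
  simpa using h1

/-- Only `k = i` is kept in Chapman–Kolmogorov. The bound is independent of `t`, so the behaviour at
time `0` gives continuity everywhere. -/
lemma abs_sub_le (hP : IsBirthDeathTransition lam mu P) {h t : ℝ} (hh : 0 ≤ h) (ht : 0 ≤ t)
    (i j : ℕ) : |P (h + t) i j - P t i j| ≤ 1 - P h i i := by
  have h1 := hP.sum_le_add hh ht i j {i}
  have h2 := hP.add_le_sum hh ht i j {i}
  simp only [Finset.sum_singleton] at h1 h2
  have h3 := hP.nonneg h hh i i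
  have h4 := hP.nonneg t ht i j
  have h5 := hP.le_one ht i j
  have h6 := hP.le_one hh i i
  rw [abs_le]
  constructor <;> nlinarith

lemma continuousOn (hP : IsBirthDeathTransition lam mu P) (i j : ℕ) :
    ContinuousOn (fun t => P t i j) (Set.Ici 0) := by
  rw [Metric.continuousOn_iff]
  intro b hb ε hε
  obtain ⟨δ, hδ, hd⟩ := Metric.mem_nhdsWithin_iff.1
    ((hP.tendsto_stay i).eventually (Metric.ball_mem_nhds 1 hε))
  refine ⟨δ, hδ, fun a ha hab => ?_⟩
  have hb : (0 : ℝ) ≤ b := hb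
  have ha : (0 : ℝ) ≤ a := ha
  have small : ∀ h, 0 < h → h < δ → 1 - P h i i < ε := by
    intro h h0 h1
    have : h ∈ Metric.ball (0 : ℝ) δ ∩ Set.Ioi 0 := ⟨by simpa [abs_of_pos h0] using h1, h0⟩
    have h2 := hd this
    simp only [Set.mem_ofPred_eq, Real.dist_eq, abs_lt] at h2
    linarith [h2.1]
  rw [Real.dist_eq] at hab ⊢
  rcases lt_trichotomy a b with hlt | heq | hgt
  · have h1 := hP.abs_sub_le (sub_nonneg.2 hlt.le) ha i j
    rw [sub_add_cancel, abs_sub_comm] at h1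
    exact h1.trans_lt (small _ (sub_pos.2 hlt) (by rw [abs_lt] at hab; linarith))
  · simpa [heq] using hε
  · have h1 := hP.abs_sub_le (sub_nonneg.2 hgt.le) hb i j
    rw [sub_add_cancel] at h1
    exact h1.trans_lt (small _ (sub_pos.2 hgt) (by rw [abs_lt] at hab; linarith))

lemma tendsto_birth (hP : IsBirthDeathTransition lam mu P) (i : ℕ) :
    Tendsto (fun h => P h i (i + 1) / h) (𝓝[>] 0) (𝓝 (lam i)) := by
  have := (hP.birth i).tendsto_div_nhds_zero.add_const (lam i)
  rw [zero_add] at this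
  refine this.congr' ?_
  filter_upwards [self_mem_nhdsWithin] with h hh
  have : h ≠ 0 := ne_of_gt hh
  field_simp
  ring

lemma tendsto_death (hP : IsBirthDeathTransition lam mu P) (i : ℕ) :
    Tendsto (fun h => P h (i + 1) i / h) (𝓝[>] 0) (𝓝 (mu (i + 1))) := by
  have := (hP.death i).tendsto_div_nhds_zero.add_const (mu (i + 1))
  rw [zero_add] at this
  refine this.congr' ?_
  filter_upwards [self_mem_nhdsWithin] with h hh
  have : h ≠ 0 := ne_of_gt hh
  field_simp
  ring

lemma tendsto_one_sub_stay (hP : IsBirthDeathTransition lam mu P) (i : ℕ) :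
    Tendsto (fun h => (P h i i - 1) / h) (𝓝[>] 0) (𝓝 (-(lam i + mu i))) := by
  have := (hP.stay i).tendsto_div_nhds_zero.add_const (-(lam i + mu i))
  rw [zero_add] at this
  refine this.congr' ?_
  filter_upwards [self_mem_nhdsWithin] with h hh
  have : h ≠ 0 := ne_of_gt hh
  field_simp
  ring

/-- If the jump rates out of `i` into the finite set `S` account for all of the rate out of `i`,
then the backward equation holds in row `i`. -/
lemma hasDerivWithinAt_of_rates (hP : IsBirthDeathTransition lam mu P) (i j : ℕ) (S : Finset ℕ)
    (hiS : i ∉ S) (q : ℕ → ℝ) (hq : ∀ k ∈ S, Tendsto (fun h => P h i k / h) (𝓝[>] 0) (𝓝 (q k)))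
    (hsum : ∑ k ∈ S, q k = lam i + mu i) {t : ℝ} (ht : 0 ≤ t) :
    HasDerivWithinAt (fun t => P t i j)
      (∑ k ∈ S, q k * P t k j - (lam i + mu i) * P t i j) (Set.Ioi t) t := by
  rw [hasDerivWithinAt_iff_tendsto_slope' (by simp)]
  have hshift : Tendsto (fun x => x - t) (𝓝[>] t) (𝓝[>] 0) := by
    refine tendsto_nhdsWithin_iff.2 ⟨?_, ?_⟩
    · have : Tendsto (fun x => x - t) (𝓝 t) (𝓝 (t - t)) := (continuous_sub_right t).tendsto t
      rw [sub_self] at this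
      exact tendsto_nhdsWithin_of_tendsto_nhds this
    · filter_upwards [self_mem_nhdsWithin] with x hx
      exact Set.mem_Ioi.2 (sub_pos.2 (Set.mem_Ioi.1 hx))
  have hlow : Tendsto (fun h => ∑ k ∈ S, P h i k / h * P t k j + (P h i i - 1) / h * P t i j)
      (𝓝[>] 0) (𝓝 (∑ k ∈ S, q k * P t k j - (lam i + mu i) * P t i j)) := by
    have := (tendsto_finsetSum S fun k hk => (hq k hk).mul_const (P t k j)).add
      ((hP.tendsto_one_sub_stay i).mul_const (P t i j))
    convert this using 2
    ring
  have herr : Tendsto (fun h => -((P h i i - 1) / h) - ∑ k ∈ S, P h i k / h) (𝓝[>] 0) (𝓝 0) := by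
    have := (hP.tendsto_one_sub_stay i).neg.sub (tendsto_finsetSum S hq)
    rwa [hsum, neg_neg, sub_self] at this
  have hup := hlow.add herr
  rw [add_zero] at hup
  -- The difference quotient is squeezed between the truncated sum and the truncated sum plus the
  -- mass outside `insert i S`. That mass is `o(h)` by `hsum`, so no interchange of a limit with an
  -- infinite sum is needed.
  refine tendsto_of_tendsto_of_tendsto_of_le_of_le' (hlow.comp hshift) (hup.comp hshift) ?_ ?_
  · filter_upwards [self_mem_nhdsWithin] with x hx
    have hpos : 0 < x - t := sub_pos.2 hx
    have h1 := hP.sum_le_add hpos.le ht i j (insert i S)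
    rw [Finset.sum_insert hiS, sub_add_cancel] at h1
    simp only [Function.comp, slope_def_field]
    rw [le_div_iff₀ hpos, add_mul, Finset.sum_mul]
    have h2 : ∀ k ∈ S, P (x - t) i k / (x - t) * P t k j * (x - t) = P (x - t) i k * P t k j :=
      fun k _ => by field_simp
    rw [Finset.sum_congr rfl h2]
    have h3 : (P (x - t) i i - 1) / (x - t) * P t i j * (x - t) = (P (x - t) i i - 1) * P t i j := by
      field_simp
    rw [h3]
    linarith
  · filter_upwards [self_mem_nhdsWithin] with x hx
    have hpos : 0 < x - t := sub_pos.2 hx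
    have h1 := hP.add_le_sum hpos.le ht i j (insert i S)
    rw [Finset.sum_insert hiS, Finset.sum_insert hiS, sub_add_cancel] at h1
    simp only [Function.comp, slope_def_field]
    rw [div_le_iff₀ hpos]
    have h2 : ∀ k ∈ S, P (x - t) i k / (x - t) * P t k j * (x - t) = P (x - t) i k * P t k j :=
      fun k _ => by field_simp
    have h4 : ∀ k ∈ S, P (x - t) i k / (x - t) * (x - t) = P (x - t) i k :=
      fun k _ => by field_simp
    have h3 : (P (x - t) i i - 1) / (x - t) * P t i j * (x - t) = (P (x - t) i i - 1) * P t i j := by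
      field_simp
    have h5 : (P (x - t) i i - 1) / (x - t) * (x - t) = P (x - t) i i - 1 := by field_simp
    rw [add_mul, add_mul, sub_mul, neg_mul, Finset.sum_mul, Finset.sum_mul,
      Finset.sum_congr rfl h2, Finset.sum_congr rfl h4, h3, h5]
    linarith

/-- Kolmogorov's backward equation. -/
lemma backward (hP : IsBirthDeathTransition lam mu P) (hmu : mu 0 = 0) (i j : ℕ) {t : ℝ}
    (ht : 0 ≤ t) :
    HasDerivWithinAt (fun t => P t i j)
      (lam i * P t (i + 1) j + mu i * P t (i - 1) j - (lam i + mu i) * P t i j) (Set.Ioi t) t := by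
  rcases i with _ | i
  · have := hP.hasDerivWithinAt_of_rates 0 j {1} (by simp) (fun _ => lam 0)
      (by simpa using hP.tendsto_birth 0) (by simp [hmu]) ht
    simpa [hmu] using this
  · have := hP.hasDerivWithinAt_of_rates (i + 1) j {i + 2, i} (by simp)
      (fun k => if k = i then mu (i + 1) else lam (i + 1))
      (by
        intro k hk
        simp only [Finset.mem_insert, Finset.mem_singleton] at hk
        rcases hk with rfl | rfl
        · simpa using hP.tendsto_birth (i + 1)
        · simpa using hP.tendsto_death k)
      (by rw [Finset.sum_pair (by simp)]; simp) ht
    rw [Finset.sum_pair (by simp)] at this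
    simpa using this

lemma integrableOn_exp_mul (hP : IsBirthDeathTransition lam mu P) (i j : ℕ) {θ : ℂ}
    (hθ : 0 < θ.re) :
    IntegrableOn (fun t : ℝ => Complex.exp (-θ * t) * (P t i j : ℂ)) (Set.Ioi 0) := by
  have hdom : IntegrableOn (fun t : ℝ => Real.exp (-θ.re * t)) (Set.Ioi 0) := by
    simpa [IntegrableOn] using exp_neg_integrableOn_Ioi 0 hθ
  refine hdom.mono' ?_ ?_
  · refine ContinuousOn.aestronglyMeasurable ?_ measurableSet_Ioi
    refine ContinuousOn.mul (by fun_prop) ?_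
    exact Complex.continuous_ofReal.comp_continuousOn
      ((hP.continuousOn i j).mono Set.Ioi_subset_Ici_self)
  · filter_upwards [ae_restrict_mem measurableSet_Ioi] with t ht
    have ht : (0 : ℝ) < t := ht
    rw [norm_mul, Complex.norm_exp, Complex.norm_real, Real.norm_of_nonneg (hP.nonneg t ht.le i j)]
    simpa using mul_le_of_le_one_right (Real.exp_pos _).le (hP.le_one ht.le i j)

lemma norm_laplaceTransform_le (hP : IsBirthDeathTransition lam mu P) (i j : ℕ) {θ : ℂ}
    (hθ : 0 < θ.re) : ‖laplaceTransform (fun t => P t i j) θ‖ ≤ 1 / θ.re := by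
  have h1 : ‖laplaceTransform (fun t => P t i j) θ‖ ≤ ∫ t in Set.Ioi (0 : ℝ), Real.exp (-θ.re * t) := by
    refine norm_integral_le_of_norm_le ?_ ?_
    · simpa [IntegrableOn] using exp_neg_integrableOn_Ioi 0 hθ
    · filter_upwards [ae_restrict_mem measurableSet_Ioi] with t ht
      have ht : (0 : ℝ) < t := ht
      rw [norm_mul, Complex.norm_exp, Complex.norm_real,
        Real.norm_of_nonneg (hP.nonneg t ht.le i j)]
      simpa using mul_le_of_le_one_right (Real.exp_pos _).le (hP.le_one ht.le i j)
  rwa [integral_exp_mul_Ioi (by linarith) 0, mul_zero, Real.exp_zero, neg_div_neg_eq] at h1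

/-- The backward equation for the resolvent. -/
lemma laplaceTransform_backward (hP : IsBirthDeathTransition lam mu P) (hmu : mu 0 = 0)
    (i j : ℕ) {θ : ℂ} (hθ : 0 < θ.re) :
    (θ + lam i + mu i) * laplaceTransform (fun t => P t i j) θ =
      lam i * laplaceTransform (fun t => P t (i + 1) j) θ
        + mu i * laplaceTransform (fun t => P t (i - 1) j) θ + (if i = j then 1 else 0) := by
  set g : ℝ → ℂ := fun t => Complex.exp (-θ * t) * (P t i j : ℂ)
  set g' : ℝ → ℂ := fun t => lam i * (Complex.exp (-θ * t) * (P t (i + 1) j : ℂ))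
    + mu i * (Complex.exp (-θ * t) * (P t (i - 1) j : ℂ))
    - (θ + lam i + mu i) * (Complex.exp (-θ * t) * (P t i j : ℂ))
  have hint : IntegrableOn g' (Set.Ioi 0) :=
    (((hP.integrableOn_exp_mul (i + 1) j hθ).const_mul _).add
      ((hP.integrableOn_exp_mul (i - 1) j hθ).const_mul _)).sub
      ((hP.integrableOn_exp_mul i j hθ).const_mul _)
  have hcont : ContinuousOn g (Set.Ici 0) :=
    ContinuousOn.mul (by fun_prop) (Complex.continuous_ofReal.comp_continuousOn (hP.continuousOn i j))
  have hder : ∀ t ∈ Set.Ici (0 : ℝ), HasDerivWithinAt g (g' t) (Set.Ioi t) t := by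
    intro t ht
    have h1 := (hP.backward hmu i j ht).ofReal_comp
    have h2 : HasDerivAt (fun t : ℝ => Complex.exp (-θ * t)) (Complex.exp (-θ * t) * (-θ * 1)) t :=
      ((hasDerivAt_id t).ofReal_comp.const_mul (-θ)).cexp
    refine (h2.hasDerivWithinAt.mul h1).congr_deriv ?_
    simp only [g']
    push_cast
    ring
  -- Only right derivatives are known; with continuity of `g` and integrability of `g'` they suffice
  -- for the fundamental theorem.
  have hftc : ∀ T : ℝ, 0 ≤ T → ∫ t in (0 : ℝ)..T, g' t = g T - g 0 := by
    intro T hT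
    refine intervalIntegral.integral_eq_sub_of_hasDeriv_right ?_ ?_ ?_
    · rw [Set.uIcc_of_le hT]
      exact hcont.mono Set.Icc_subset_Ici_self
    · intro t ht
      rw [min_eq_left hT] at ht
      exact hder t ht.1.le
    · rw [intervalIntegrable_iff_integrableOn_Ioc_of_le hT]
      exact hint.mono_set Set.Ioc_subset_Ioi_self
  have hlim := intervalIntegral_tendsto_integral_Ioi 0 hint tendsto_id
  have hg : Tendsto g atTop (𝓝 0) := by
    rw [tendsto_zero_iff_norm_tendsto_zero]
    have hexp : Tendsto (fun t : ℝ => Real.exp (-θ.re * t)) atTop (𝓝 0) := by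
      refine Real.tendsto_exp_atBot.comp ?_
      exact tendsto_id.const_mul_atTop_of_neg (by linarith)
    refine squeeze_zero' (Eventually.of_forall fun t => norm_nonneg _) ?_ hexp
    filter_upwards [eventually_ge_atTop 0] with t ht
    rw [norm_mul, Complex.norm_exp, Complex.norm_real, Real.norm_of_nonneg (hP.nonneg t ht i j)]
    simpa using mul_le_of_le_one_right (Real.exp_pos _).le (hP.le_one ht i j)
  have hlim2 : Tendsto (fun T : ℝ => ∫ t in (0 : ℝ)..T, g' t) atTop (𝓝 (0 - g 0)) := by
    refine (hg.sub_const (g 0)).congr' ?_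
    filter_upwards [eventually_ge_atTop 0] with T hT
    exact (hftc T hT).symm
  have heq := tendsto_nhds_unique hlim hlim2
  have hI : ∫ t in Set.Ioi (0 : ℝ), g' t = lam i * laplaceTransform (fun t => P t (i + 1) j) θ
      + mu i * laplaceTransform (fun t => P t (i - 1) j) θ
      - (θ + lam i + mu i) * laplaceTransform (fun t => P t i j) θ := by
    simp only [g']
    rw [integral_sub, integral_add, integral_const_mul, integral_const_mul, integral_const_mul]
    · rfl
    · exact (hP.integrableOn_exp_mul (i + 1) j hθ).const_mul _
    · exact (hP.integrableOn_exp_mul (i - 1) j hθ).const_mul _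
    · exact ((hP.integrableOn_exp_mul (i + 1) j hθ).const_mul _).add
        ((hP.integrableOn_exp_mul (i - 1) j hθ).const_mul _)
    · exact (hP.integrableOn_exp_mul i j hθ).const_mul _
  have hg0 : g 0 = if i = j then 1 else 0 := by
    simp only [g, hP.zero]
    split_ifs <;> simp
  rw [hI, hg0] at heq
  linear_combination -heq

end IsBirthDeathTransition

/-! ### Uniqueness of bounded solutions, and identification of `p_n(t)`. -/

/-- A bounded solution of the homogeneous backward equation with constant birth rate vanishes. -/
lemma eq_zero_of_bounded_backward {ρ : ℝ} (hρ : 0 < ρ) {mu : ℕ → ℝ}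
    (hmu : ∀ i, 0 ≤ mu i) {θ : ℂ} (hθ : 0 < θ.re) {u : ℕ → ℂ} {C : ℝ} (hC : ∀ i, ‖u i‖ ≤ C)
    (hu : ∀ i, (θ + ρ + mu i) * u i = ρ * u (i + 1) + mu i * u (i - 1)) (i : ℕ) : u i = 0 := by
  have step : ∀ i, (θ.re + ρ + mu i) * ‖u i‖ ≤ ρ * ‖u (i + 1)‖ + mu i * ‖u (i - 1)‖ := by
    intro i
    have h1 : θ.re + ρ + mu i ≤ ‖θ + ρ + mu i‖ := by
      simpa using Complex.re_le_norm (θ + ρ + mu i)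
    calc (θ.re + ρ + mu i) * ‖u i‖ ≤ ‖θ + ρ + mu i‖ * ‖u i‖ := by gcongr
      _ = ‖ρ * u (i + 1) + mu i * u (i - 1)‖ := by rw [← norm_mul, hu]
      _ ≤ ‖(ρ : ℂ) * u (i + 1)‖ + ‖(mu i : ℂ) * u (i - 1)‖ := norm_add_le _ _
      _ = _ := by
        rw [norm_mul, norm_mul, Complex.norm_real, Complex.norm_real, Real.norm_of_nonneg hρ.le,
          Real.norm_of_nonneg (hmu i)]
  have grow : ∀ i, ‖u (i - 1)‖ ≤ ‖u i‖ → (1 + θ.re / ρ) * ‖u i‖ ≤ ‖u (i + 1)‖ := by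
    intro i hi
    have h1 := step i
    have h2 := mul_le_mul_of_nonneg_left hi (hmu i)
    rw [← mul_le_mul_iff_right₀ hρ]
    have : ρ * ((1 + θ.re / ρ) * ‖u i‖) = (θ.re + ρ) * ‖u i‖ := by field_simp; ring
    rw [this]
    linarith
  have hr : 1 < 1 + θ.re / ρ := by
    have := div_pos hθ hρ
    linarith
  -- The induction starts for free: truncated subtraction makes the claim at `0` an equality.
  have mono : ∀ i, ‖u (i - 1)‖ ≤ ‖u i‖ := by
    intro i
    induction i with
    | zero => simp
    | succ i ih =>
      have := grow i ih
      simp only [Nat.add_sub_cancel]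
      nlinarith [norm_nonneg (u i)]
  have pow : ∀ k, (1 + θ.re / ρ) ^ k * ‖u i‖ ≤ ‖u (i + k)‖ := by
    intro k
    induction k with
    | zero => simp
    | succ k ih =>
      calc (1 + θ.re / ρ) ^ (k + 1) * ‖u i‖ = (1 + θ.re / ρ) * ((1 + θ.re / ρ) ^ k * ‖u i‖) := by ring
        _ ≤ (1 + θ.re / ρ) * ‖u (i + k)‖ := by gcongr
        _ ≤ ‖u (i + (k + 1))‖ := grow _ (mono _)
  by_contra hne
  have hpos : 0 < ‖u i‖ := norm_pos_iff.2 hne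
  obtain ⟨k, hk⟩ := pow_unbounded_of_one_lt (C / ‖u i‖) hr
  rw [div_lt_iff₀ hpos] at hk
  linarith [pow k, hC (i + k)]

lemma transientProb_eq {Ω : Type*} [MeasurableSpace Ω] {μ : Measure Ω} [IsProbabilityMeasure μ]
    {N : ℝ → Ω → ℕ} (hN : Measurable (N 0)) {P : ℝ → ℕ → ℕ → ℝ}
    (hP : ∀ (k : ℕ) (t : ℕ → ℝ) (i : ℕ → ℕ), 0 ≤ t 0 → Monotone t →
      μ.real {ω | ∀ l ≤ k + 1, N (t l) ω = i l} =
        μ.real {ω | ∀ l ≤ k, N (t l) ω = i l} * P (t (k + 1) - t k) (i k) (i (k + 1)))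
    {n₀ : ℕ} (hinit : μ (N 0 ⁻¹' {n₀}) ≠ 0) (n : ℕ) {t : ℝ} (ht : 0 ≤ t) :
    transientProb μ N n₀ n t = P t n₀ n := by
  -- The history consists of the times `0` and `t` only; the remaining entries just keep the
  -- sequence monotone.
  have h := hP 0 (fun l => if l = 0 then 0 else t) (fun l => if l = 0 then n₀ else n) (by simp)
    (by
      intro a b hab
      rcases Nat.eq_zero_or_pos a with rfl | ha
      · by_cases hb : b = 0 <;> simp [hb, ht]
      · simp [ha.ne', (ha.trans_le hab).ne'])
  have e1 : {ω | ∀ l ≤ 0 + 1, N (if l = 0 then 0 else t) ω = if l = 0 then n₀ else n} =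
      N 0 ⁻¹' {n₀} ∩ N t ⁻¹' {n} := by
    ext ω
    simp only [Set.mem_ofPred_eq, Set.mem_inter_iff, Set.mem_preimage, Set.mem_singleton_iff]
    constructor
    · intro h
      exact ⟨by simpa using h 0 (by simp), by simpa using h 1 (by simp)⟩
    · rintro ⟨h0, h1⟩ l hl
      interval_cases l <;> simp [h0, h1]
  have e2 : {ω | ∀ l ≤ 0, N (if l = 0 then 0 else t) ω = if l = 0 then n₀ else n} =
      N 0 ⁻¹' {n₀} := by
    ext ω
    simp
  rw [e1, e2] at h
  simp only [zero_add, one_ne_zero, if_true, if_false, sub_zero] at h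
  have hne : μ.real (N 0 ⁻¹' {n₀}) ≠ 0 := by
    rw [Measure.real, ENNReal.toReal_ne_zero]
    exact ⟨hinit, measure_ne_top _ _⟩
  rw [transientProb, Measure.real, ProbabilityTheory.cond_apply (hN (measurableSet_singleton n₀)),
    ENNReal.toReal_mul, ENNReal.toReal_inv, ← Measure.real, ← Measure.real, h]
  field_simp

/-! ### Calculus of loop integrals. -/

/-- The trace of the contour of `loopIntegral a ε`. -/
def loopSet (a ε : ℝ) : Set ℂ :=
  {z | z.re ≤ a ∧ (z.im = ε ∨ z.im = -ε)} ∪ {z | z.re = a ∧ z.im ∈ Set.Icc (-ε) ε}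

lemma upper_mem_loopSet {a x : ℝ} (ε : ℝ) (hx : x ≤ a) : (x + ε * Complex.I : ℂ) ∈ loopSet a ε :=
  Or.inl ⟨by simpa using hx, Or.inl (by simp)⟩

lemma lower_mem_loopSet {a x : ℝ} (ε : ℝ) (hx : x ≤ a) : (x - ε * Complex.I : ℂ) ∈ loopSet a ε :=
  Or.inl ⟨by simpa using hx, Or.inr (by simp)⟩

lemma right_mem_loopSet (a : ℝ) {ε y : ℝ} (hy : y ∈ Set.Icc (-ε) ε) :
    (a + y * Complex.I : ℂ) ∈ loopSet a ε :=
  Or.inr ⟨by simp, by simpa using hy⟩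

/-- Integrability along the three parts of the contour of `loopIntegral a ε`. -/
structure LoopIntegrable (a ε : ℝ) (f : ℂ → ℂ) : Prop where
  lower : IntegrableOn (fun x : ℝ => f (x - ε * Complex.I)) (Set.Iic a)
  right : IntervalIntegrable (fun y : ℝ => f (a + y * Complex.I)) volume (-ε) ε
  upper : IntegrableOn (fun x : ℝ => f (x + ε * Complex.I)) (Set.Iic a)

lemma LoopIntegrable.add {a ε : ℝ} {f g : ℂ → ℂ} (hf : LoopIntegrable a ε f)
    (hg : LoopIntegrable a ε g) : LoopIntegrable a ε (fun z => f z + g z) :=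
  ⟨hf.lower.add hg.lower, hf.right.add hg.right, hf.upper.add hg.upper⟩

lemma LoopIntegrable.const_mul {a ε : ℝ} {f : ℂ → ℂ} (hf : LoopIntegrable a ε f) (c : ℂ) :
    LoopIntegrable a ε (fun z => c * f z) :=
  ⟨hf.lower.const_mul c, hf.right.const_mul c, hf.upper.const_mul c⟩

lemma loopIntegral_add {a ε : ℝ} {f g : ℂ → ℂ} (hf : LoopIntegrable a ε f)
    (hg : LoopIntegrable a ε g) :
    loopIntegral a ε (fun z => f z + g z) = loopIntegral a ε f + loopIntegral a ε g := by
  simp only [loopIntegral]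
  rw [integral_add hf.lower hg.lower, integral_add hf.upper hg.upper,
    intervalIntegral.integral_add hf.right hg.right]
  ring

lemma loopIntegral_const_mul (a ε : ℝ) (c : ℂ) (f : ℂ → ℂ) :
    loopIntegral a ε (fun z => c * f z) = c * loopIntegral a ε f := by
  simp only [loopIntegral]
  rw [integral_const_mul, integral_const_mul, intervalIntegral.integral_const_mul]
  ring

lemma loopIntegral_congr {a ε : ℝ} (hε : 0 ≤ ε) {f g : ℂ → ℂ} (h : Set.EqOn f g (loopSet a ε)) :
    loopIntegral a ε f = loopIntegral a ε g := by
  simp only [loopIntegral]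
  congr 1
  · congr 1
    · exact setIntegral_congr_fun measurableSet_Iic fun x hx => h (lower_mem_loopSet ε hx)
    · congr 1
      refine intervalIntegral.integral_congr fun y hy => h (right_mem_loopSet a ?_)
      rwa [Set.uIcc_of_le (by linarith)] at hy
  · exact setIntegral_congr_fun measurableSet_Iic fun x hx => h (upper_mem_loopSet ε hx)

lemma loopIntegrable_of_bound {a ε : ℝ} (hε : 0 ≤ ε) {f : ℂ → ℂ} {c C : ℝ} (hc : 0 < c)
    (hf : ContinuousOn f (loopSet a ε)) (hb : ∀ z ∈ loopSet a ε, ‖f z‖ ≤ C * Real.exp (c * z.re)) :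
    LoopIntegrable a ε f := by
  have hexp : IntegrableOn (fun x : ℝ => C * Real.exp (c * x)) (Set.Iic a) :=
    (integrableOn_exp_mul_Iic hc a).const_mul C
  refine ⟨hexp.mono' ?_ ?_, ?_, hexp.mono' ?_ ?_⟩
  · exact (hf.comp (by fun_prop) fun x hx => lower_mem_loopSet ε hx).aestronglyMeasurable
      measurableSet_Iic
  · filter_upwards [ae_restrict_mem measurableSet_Iic] with x hx
    simpa using hb _ (lower_mem_loopSet ε hx)
  · refine (hf.comp (by fun_prop) fun y hy => right_mem_loopSet a ?_).intervalIntegrable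
    rwa [Set.uIcc_of_le (by linarith)] at hy
  · exact (hf.comp (by fun_prop) fun x hx => upper_mem_loopSet ε hx).aestronglyMeasurable
      measurableSet_Iic
  · filter_upwards [ae_restrict_mem measurableSet_Iic] with x hx
    simpa using hb _ (upper_mem_loopSet ε hx)

/-- The integral of a derivative over the loop vanishes if the primitive decays at `-∞`. -/
lemma loopIntegral_deriv_eq_zero {a ε : ℝ} (hε : 0 ≤ ε) {g g' : ℂ → ℂ} {c C : ℝ} (hc : 0 < c)
    (hg : ∀ z ∈ loopSet a ε, HasDerivAt g (g' z) z)
    (hb : ∀ z ∈ loopSet a ε, ‖g z‖ ≤ C * Real.exp (c * z.re))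
    (hg' : LoopIntegrable a ε g') : loopIntegral a ε g' = 0 := by
  have hexp : Tendsto (fun x : ℝ => C * Real.exp (c * x)) atBot (𝓝 0) := by
    simpa using (Real.tendsto_exp_atBot.comp (tendsto_id.const_mul_atBot hc)).const_mul C
  have h1 : ∫ x in Set.Iic a, g' (x - ε * Complex.I) = g (a - ε * Complex.I) - 0 := by
    refine integral_Iic_of_hasDerivAt_of_tendsto' (f := fun x : ℝ => g (x - ε * Complex.I)) ?_
      hg'.lower ?_
    · intro x hx
      refine ((hg _ (lower_mem_loopSet ε hx)).comp x
        ((hasDerivAt_id x).ofReal_comp.sub_const (ε * Complex.I))).congr_deriv ?_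
      simp
    · rw [tendsto_zero_iff_norm_tendsto_zero]
      refine squeeze_zero' (Eventually.of_forall fun t => norm_nonneg _) ?_ hexp
      filter_upwards [eventually_le_atBot a] with x hx
      simpa using hb _ (lower_mem_loopSet ε hx)
  have h2 : ∫ x in Set.Iic a, g' (x + ε * Complex.I) = g (a + ε * Complex.I) - 0 := by
    refine integral_Iic_of_hasDerivAt_of_tendsto' (f := fun x : ℝ => g (x + ε * Complex.I)) ?_
      hg'.upper ?_
    · intro x hx
      refine ((hg _ (upper_mem_loopSet ε hx)).comp x
        ((hasDerivAt_id x).ofReal_comp.add_const (ε * Complex.I))).congr_deriv ?_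
      simp
    · rw [tendsto_zero_iff_norm_tendsto_zero]
      refine squeeze_zero' (Eventually.of_forall fun t => norm_nonneg _) ?_ hexp
      filter_upwards [eventually_le_atBot a] with x hx
      simpa using hb _ (upper_mem_loopSet ε hx)
  have h3 : ∫ y in (-ε)..ε, g' (a + y * Complex.I) * Complex.I =
      g (a + ε * Complex.I) - g (a + (-ε : ℝ) * Complex.I) := by
    refine intervalIntegral.integral_eq_sub_of_hasDerivAt
      (f := fun y : ℝ => g (a + y * Complex.I)) ?_ (hg'.right.mul_const _)
    intro y hy
    rw [Set.uIcc_of_le (by linarith)] at hy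
    refine ((hg _ (right_mem_loopSet a hy)).comp y
      (((hasDerivAt_id y).ofReal_comp.mul_const Complex.I).const_add (a : ℂ))).congr_deriv ?_
    simp
  rw [intervalIntegral.integral_mul_const] at h3
  rw [loopIntegral, h1, h2, mul_comm Complex.I, h3]
  push_cast
  ring_nf

/-! ### Unfolding a loop to a vertical line. -/

lemma tendsto_mul_rpow_neg_atTop {p : ℝ} (hp : 1 < p) (K a : ℝ) :
    Tendsto (fun R : ℝ => K * R ^ (-p) * |a + R|) atTop (𝓝 0) := by
  have h1 : Tendsto (fun R : ℝ => R ^ (-(p - 1))) atTop (𝓝 0) :=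
    tendsto_rpow_neg_atTop (by linarith)
  have h2 : Tendsto (fun R : ℝ => R ^ (-p)) atTop (𝓝 0) := tendsto_rpow_neg_atTop (by linarith)
  have h3 := (((h2.const_mul a).add h1).abs).const_mul K
  simp only [mul_zero, add_zero, abs_zero] at h3
  refine h3.congr' ?_
  filter_upwards [eventually_gt_atTop 0] with R hR
  have : R ^ (-(p - 1)) = R ^ (-p) * R := by
    rw [← Real.rpow_add_one hR.ne']
    congr 1
    ring
  rw [this, mul_assoc, ← abs_of_pos (Real.rpow_pos_of_pos hR (-p)), ← abs_mul,
    abs_of_pos (Real.rpow_pos_of_pos hR (-p))]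
  ring_nf

lemma tendsto_mul_exp_neg_atTop {c : ℝ} (hc : 0 < c) (K b : ℝ) :
    Tendsto (fun R : ℝ => K * Real.exp (c * (-R)) * |R + b|) atTop (𝓝 0) := by
  have h1 : Tendsto (fun R : ℝ => R * Real.exp (-c * R)) atTop (𝓝 0) := by
    simpa using tendsto_rpow_mul_exp_neg_mul_atTop_nhds_zero 1 c hc
  have h2 : Tendsto (fun R : ℝ => Real.exp (-c * R)) atTop (𝓝 0) := by
    simpa using tendsto_rpow_mul_exp_neg_mul_atTop_nhds_zero 0 c hc
  have h3 := ((h1.add (h2.const_mul b)).abs).const_mul K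
  simp only [mul_zero, add_zero, abs_zero] at h3
  refine h3.congr fun R => ?_
  rw [← add_mul, abs_mul, abs_of_pos (Real.exp_pos _)]
  ring_nf

lemma tendsto_horizontal {a c C p : ℝ} (hc : 0 < c) (hC : 0 ≤ C) (hp : 1 < p) {F : ℝ → ℝ → ℂ}
    (hF : ∀ᶠ R in atTop, ∀ x, x ≤ a → ‖F R x‖ ≤ C * Real.exp (c * x) * R ^ (-p)) :
    Tendsto (fun R : ℝ => ∫ x in (-R)..a, F R x) atTop (𝓝 0) := by
  rw [tendsto_zero_iff_norm_tendsto_zero]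
  refine squeeze_zero' (Eventually.of_forall fun t => norm_nonneg _) ?_
    (tendsto_mul_rpow_neg_atTop hp (C * Real.exp (c * a)) a)
  filter_upwards [hF, eventually_gt_atTop 0, eventually_gt_atTop (-a)] with R hR h0 hRa
  have := intervalIntegral.norm_integral_le_of_norm_le_const (a := -R) (b := a) (f := F R)
    (C := C * Real.exp (c * a) * R ^ (-p)) (fun x hx => by
      rw [Set.uIoc_of_le (by linarith)] at hx
      refine (hR x hx.2).trans ?_
      have := hx.2
      gcongr)
  rwa [sub_neg_eq_add] at this

/-- If the integrand decays fast enough then the loop can be unfolded to a vertical line. -/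
lemma loopIntegral_eq_integral_vertical {a ε c C p : ℝ} (hε : 0 < ε) (hc : 0 < c) (hC : 0 ≤ C)
    (hp : 1 < p) {f : ℂ → ℂ}
    (hf : ∀ z : ℂ, z.re ≤ a → ε ≤ |z.im| → DifferentiableAt ℂ f z)
    (hfa : ∀ z ∈ loopSet a ε, DifferentiableAt ℂ f z)
    (hb : ∀ z : ℂ, z.re ≤ a → ε ≤ |z.im| → ‖f z‖ ≤ C * Real.exp (c * z.re) * |z.im| ^ (-p)) :
    loopIntegral a ε f = Complex.I * ∫ y : ℝ, f (a + y * Complex.I) := by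
  have hbε : ∀ z : ℂ, z.re ≤ a → ε ≤ |z.im| → ‖f z‖ ≤ C * ε ^ (-p) * Real.exp (c * z.re) := by
    intro z h1 h2
    refine (hb z h1 h2).trans ?_
    have : |z.im| ^ (-p) ≤ ε ^ (-p) := Real.rpow_le_rpow_of_nonpos hε h2 (by linarith)
    calc C * Real.exp (c * z.re) * |z.im| ^ (-p) ≤ C * Real.exp (c * z.re) * ε ^ (-p) := by gcongr
      _ = _ := by ring
  have hexp : IntegrableOn (fun x : ℝ => C * ε ^ (-p) * Real.exp (c * x)) (Set.Iic a) :=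
    (integrableOn_exp_mul_Iic hc a).const_mul _
  have hcont : ContinuousOn f (loopSet a ε) := fun z hz => (hfa z hz).continuousAt.continuousWithinAt
  have hUI : IntegrableOn (fun x : ℝ => f (x + ε * Complex.I)) (Set.Iic a) := by
    refine hexp.mono' ((hcont.comp (by fun_prop) fun x hx =>
      upper_mem_loopSet ε hx).aestronglyMeasurable measurableSet_Iic) ?_
    filter_upwards [ae_restrict_mem measurableSet_Iic] with x hx
    simpa using hbε (x + ε * Complex.I) (by simpa using hx) (by simp [abs_of_pos hε])
  have hLI : IntegrableOn (fun x : ℝ => f (x - ε * Complex.I)) (Set.Iic a) := by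
    refine hexp.mono' ((hcont.comp (by fun_prop) fun x hx =>
      lower_mem_loopSet ε hx).aestronglyMeasurable measurableSet_Iic) ?_
    filter_upwards [ae_restrict_mem measurableSet_Iic] with x hx
    simpa using hbε (x - ε * Complex.I) (by simpa using hx) (by simp [abs_of_pos hε])
  have hvert : Continuous (fun y : ℝ => f (a + y * Complex.I)) := by
    refine continuous_iff_continuousAt.2 fun y => ?_
    have hd : DifferentiableAt ℂ f (a + y * Complex.I) := by
      by_cases hy : ε ≤ |y|
      · exact hf _ (by simp) (by simpa using hy)
      · exact hfa _ (right_mem_loopSet a (abs_le.1 (not_le.1 hy).le))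
    exact ContinuousAt.comp (g := f) hd.continuousAt (by fun_prop)
  have hRI : IntegrableOn (fun y : ℝ => f (a + y * Complex.I)) (Set.Ioi ε) := by
    refine ((integrableOn_Ioi_rpow_of_lt (by linarith : -p < -1) hε).const_mul
      (C * Real.exp (c * a))).mono' hvert.aestronglyMeasurable ?_
    filter_upwards [ae_restrict_mem measurableSet_Ioi] with y hy
    have hy : ε < y := hy
    have := hb (a + y * Complex.I) (by simp) (by simpa using hy.le.trans (le_abs_self y))
    simpa [abs_of_pos (hε.trans hy)] using this
  have hRI' : IntegrableOn (fun y : ℝ => f (a + y * Complex.I)) (Set.Iic (-ε)) := by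
    have h0 : IntegrableOn (fun y : ℝ => C * Real.exp (c * a) * (-y) ^ (-p)) (Set.Iic (-ε)) := by
      rw [integrableOn_Iic_iff_integrableOn_Iio]
      have : IntegrableOn (fun y : ℝ => C * Real.exp (c * a) * y ^ (-p)) (Set.Ioi (- -ε)) := by
        rw [neg_neg]
        exact (integrableOn_Ioi_rpow_of_lt (by linarith : -p < -1) hε).const_mul _
      exact this.comp_neg_Iio
    refine h0.mono' hvert.aestronglyMeasurable ?_
    filter_upwards [ae_restrict_mem measurableSet_Iic] with y hy
    have hy : y ≤ -ε := hy
    have := hb (a + y * Complex.I) (by simp) (by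
      rw [abs_of_neg (by simpa using by linarith)]
      simpa using by linarith)
    simpa [abs_of_neg (by linarith : y < 0)] using this
  -- Cauchy's theorem on `[-R, a] × [ε, R]`: the left side dies exponentially, while the top side
  -- has length `a + R` and dies because `p > 1`. `hL` is the mirror image.
  have hU : (∫ x in Set.Iic a, f (x + ε * Complex.I))
      + Complex.I * ∫ y in Set.Ioi ε, f (a + y * Complex.I) = 0 := by
    have t1 := intervalIntegral_tendsto_integral_Iic a hUI tendsto_neg_atTop_atBot
    have t2 := intervalIntegral_tendsto_integral_Ioi ε hRI tendsto_id
    have t3 : Tendsto (fun R : ℝ => ∫ x in (-R)..a, f (x + R * Complex.I)) atTop (𝓝 0) := by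
      refine tendsto_horizontal hc hC hp (a := a) (F := fun R x => f (x + R * Complex.I)) ?_
      filter_upwards [eventually_ge_atTop ε] with R hR x hx
      have := hb (x + R * Complex.I) (by simpa using hx) (by simpa using hR.trans (le_abs_self R))
      simpa [abs_of_pos (hε.trans_le hR)] using this
    have t4 : Tendsto (fun R : ℝ => ∫ y in ε..R, f ((-R : ℝ) + y * Complex.I)) atTop (𝓝 0) := by
      rw [tendsto_zero_iff_norm_tendsto_zero]
      refine squeeze_zero' (Eventually.of_forall fun t => norm_nonneg _) ?_
        (tendsto_mul_exp_neg_atTop hc (C * ε ^ (-p)) (-ε))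
      filter_upwards [eventually_ge_atTop ε, eventually_ge_atTop (-a)] with R hR hRa
      refine intervalIntegral.norm_integral_le_of_norm_le_const fun y hy => ?_
      rw [Set.uIoc_of_le hR] at hy
      simpa using hbε ((-R : ℝ) + y * Complex.I) (by simpa using by linarith)
        (by simpa using hy.1.le.trans (le_abs_self y))
    have t := ((t1.sub t3).add (t2.const_mul Complex.I)).sub (t4.const_mul Complex.I)
    simp only [sub_zero, mul_zero] at t
    refine tendsto_nhds_unique t (tendsto_const_nhds.congr' ?_)
    filter_upwards [eventually_ge_atTop ε, eventually_ge_atTop (-a)] with R hR hRa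
    have := Complex.integral_boundary_rect_eq_zero_of_differentiableOn f
      ((-R : ℝ) + ε * Complex.I) (a + R * Complex.I) (by
        intro z hz
        refine (hf z ?_ ?_).differentiableWithinAt
        · have := hz.1
          simp [Set.uIcc_of_le (by linarith : -R ≤ a)] at this
          exact this.2
        · have := hz.2
          simp [Set.uIcc_of_le hR] at this
          exact this.1.trans (le_abs_self _))
    simpa using this.symm
  have hL : -(∫ x in Set.Iic a, f (x - ε * Complex.I))
      + Complex.I * ∫ y in Set.Iic (-ε), f (a + y * Complex.I) = 0 := by
    have t1 := intervalIntegral_tendsto_integral_Iic a hLI tendsto_neg_atTop_atBot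
    have t2 := intervalIntegral_tendsto_integral_Iic (-ε) hRI' tendsto_neg_atTop_atBot
    have t3 : Tendsto (fun R : ℝ => ∫ x in (-R)..a, f (x - R * Complex.I)) atTop (𝓝 0) := by
      refine tendsto_horizontal hc hC hp (a := a) (F := fun R x => f (x - R * Complex.I)) ?_
      filter_upwards [eventually_ge_atTop ε] with R hR x hx
      have := hb (x - R * Complex.I) (by simpa using hx) (by simpa using hR.trans (le_abs_self R))
      simpa [abs_of_pos (hε.trans_le hR)] using this
    have t4 : Tendsto (fun R : ℝ => ∫ y in (-R)..(-ε), f ((-R : ℝ) + y * Complex.I)) atTop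
        (𝓝 0) := by
      rw [tendsto_zero_iff_norm_tendsto_zero]
      refine squeeze_zero' (Eventually.of_forall fun t => norm_nonneg _) ?_
        (tendsto_mul_exp_neg_atTop hc (C * ε ^ (-p)) (-ε))
      filter_upwards [eventually_ge_atTop ε, eventually_ge_atTop (-a)] with R hR hRa
      rw [show |R + -ε| = |-ε - -R| by ring_nf]
      refine intervalIntegral.norm_integral_le_of_norm_le_const fun y hy => ?_
      rw [Set.uIoc_of_le (by linarith)] at hy
      simpa using hbε ((-R : ℝ) + y * Complex.I) (by simpa using by linarith)
        (by simpa using (by linarith [hy.2] : ε ≤ -y).trans (neg_le_abs y))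
    have t := ((t3.sub t1).add (t2.const_mul Complex.I)).sub (t4.const_mul Complex.I)
    simp only [zero_sub, sub_zero, mul_zero] at t
    refine tendsto_nhds_unique t (tendsto_const_nhds.congr' ?_)
    filter_upwards [eventually_ge_atTop ε, eventually_ge_atTop (-a)] with R hR hRa
    have := Complex.integral_boundary_rect_eq_zero_of_differentiableOn f
      ((-R : ℝ) + (-R : ℝ) * Complex.I) (a + (-ε : ℝ) * Complex.I) (by
        intro z hz
        refine (hf z ?_ ?_).differentiableWithinAt
        · have := hz.1
          simp [Set.uIcc_of_le (by linarith : -R ≤ a)] at this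
          exact this.2
        · have := hz.2
          simp [Set.uIcc_of_le (by linarith : -R ≤ -ε)] at this
          exact (by linarith [this.2] : ε ≤ -z.im).trans (neg_le_abs _))
    simpa [sub_eq_add_neg] using this.symm
  have hsplit : ∫ y : ℝ, f (a + y * Complex.I) = (∫ y in Set.Iic (-ε), f (a + y * Complex.I))
      + (∫ y in (-ε)..ε, f (a + y * Complex.I)) + ∫ y in Set.Ioi ε, f (a + y * Complex.I) := by
    have hmid := hvert.integrableOn_Ioc (a := -ε) (b := ε) (μ := volume)
    have hIic : IntegrableOn (fun y : ℝ => f (a + y * Complex.I)) (Set.Iic ε) := by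
      rw [← Set.Iic_union_Ioc_eq_Iic (by linarith : -ε ≤ ε)]
      exact hRI'.union hmid
    rw [← intervalIntegral.integral_Iic_add_Ioi hIic hRI,
      ← intervalIntegral.integral_Iic_sub_Iic hRI' hIic]
    ring
  rw [hsplit, loopIntegral]
  linear_combination -hU - hL

/-! ### Euler's Gamma integral and the inverse Laplace transform of powers. -/

lemma integrableOn_rpow_mul_exp_neg_mul {s b : ℝ} (hs : 0 < s) (hb : 0 < b) :
    IntegrableOn (fun t : ℝ => t ^ (s - 1) * Real.exp (-b * t)) (Set.Ioi 0) := by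
  simpa using integrableOn_rpow_mul_exp_neg_mul_rpow (p := 1) (s := s - 1) (b := b)
    (by linarith) one_pos hb

lemma norm_cpow_mul_exp (α w : ℂ) {t : ℝ} (ht : 0 < t) :
    ‖(t : ℂ) ^ (α - 1) * Complex.exp (-(w * t))‖ = t ^ (α.re - 1) * Real.exp (-w.re * t) := by
  rw [norm_mul, Complex.norm_cpow_eq_rpow_re_of_pos ht, Complex.norm_exp]
  simp

lemma continuousOn_cpow_mul_exp (α w : ℂ) :
    ContinuousOn (fun t : ℝ => (t : ℂ) ^ (α - 1) * Complex.exp (-(w * t))) (Set.Ioi 0) := by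
  refine ContinuousOn.mul (fun t ht => ?_) (by fun_prop)
  exact (Complex.continuousAt_ofReal_cpow_const t (α - 1)
    (Or.inr (ne_of_gt ht))).continuousWithinAt

lemma integrableOn_cpow_mul_exp {α w : ℂ} (hα : 0 < α.re) (hw : 0 < w.re) :
    IntegrableOn (fun t : ℝ => (t : ℂ) ^ (α - 1) * Complex.exp (-(w * t))) (Set.Ioi 0) := by
  refine (integrableOn_rpow_mul_exp_neg_mul hα hw).mono'
    ((continuousOn_cpow_mul_exp α w).aestronglyMeasurable measurableSet_Ioi) ?_
  filter_upwards [ae_restrict_mem measurableSet_Ioi] with t ht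
  rw [norm_cpow_mul_exp α w ht]

lemma differentiableAt_integral_cpow_mul_exp {α w : ℂ} (hα : 0 < α.re) (hw : 0 < w.re) :
    DifferentiableAt ℂ (fun w : ℂ => ∫ t in Set.Ioi (0 : ℝ),
      (t : ℂ) ^ (α - 1) * Complex.exp (-(w * t))) w := by
  have hball : ∀ x ∈ Metric.ball w (w.re / 2), w.re / 2 ≤ x.re := by
    intro x hx
    have h1 := Complex.abs_re_le_norm (x - w)
    rw [Metric.mem_ball, dist_eq_norm] at hx
    rw [Complex.sub_re] at h1
    linarith [(abs_le.1 h1).1]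
  refine (hasDerivAt_integral_of_dominated_loc_of_deriv_le (μ := volume.restrict (Set.Ioi 0))
    (F := fun w (t : ℝ) => (t : ℂ) ^ (α - 1) * Complex.exp (-(w * t)))
    (F' := fun w (t : ℝ) => (t : ℂ) ^ (α - 1) * (Complex.exp (-(w * t)) * (-t)))
    (bound := fun t => t ^ (α.re + 1 - 1) * Real.exp (-(w.re / 2) * t))
    (Metric.ball_mem_nhds w (by linarith : 0 < w.re / 2)) ?_ (integrableOn_cpow_mul_exp hα hw)
    ?_ ?_ (integrableOn_rpow_mul_exp_neg_mul (by linarith) (by linarith)) ?_).2.differentiableAt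
  · exact Eventually.of_forall fun x =>
      (continuousOn_cpow_mul_exp α x).aestronglyMeasurable measurableSet_Ioi
  · refine ContinuousOn.aestronglyMeasurable ?_ measurableSet_Ioi
    have : ContinuousOn (fun t : ℝ => (t : ℂ) ^ (α - 1) * Complex.exp (-(w * t)) * (-t))
      (Set.Ioi 0) := (continuousOn_cpow_mul_exp α w).mul (by fun_prop)
    simpa only [mul_assoc] using this
  · filter_upwards [ae_restrict_mem measurableSet_Ioi] with t ht x hx
    have ht : 0 < t := ht
    rw [← mul_assoc, norm_mul, norm_cpow_mul_exp α x ht, norm_neg, Complex.norm_real,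
      Real.norm_of_nonneg ht.le, mul_right_comm, ← Real.rpow_add_one ht.ne',
      show α.re - 1 + 1 = α.re + 1 - 1 by ring]
    have := hball x hx
    gcongr
  · filter_upwards with t x hx
    have h1 : HasDerivAt (fun x : ℂ => -(x * t)) (-(1 * (t : ℂ))) x :=
      ((hasDerivAt_id x).mul_const (t : ℂ)).neg
    refine (h1.cexp.const_mul _).congr_deriv ?_
    simp

/-- Euler's integral `∫₀^∞ t^(α-1) e^(-wt) dt = w^(-α) Γ(α)` in the half-plane `Re w > 0`. -/
lemma integral_cpow_mul_exp_neg_mul {α w : ℂ} (hα : 0 < α.re) (hw : 0 < w.re) :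
    ∫ t in Set.Ioi (0 : ℝ), (t : ℂ) ^ (α - 1) * Complex.exp (-(w * t)) =
      w ^ (-α) * Complex.Gamma α := by
  have hopen : IsOpen {z : ℂ | 0 < z.re} := isOpen_lt continuous_const Complex.continuous_re
  have hconn : IsPreconnected {z : ℂ | 0 < z.re} := (convex_halfSpace_re_gt 0).isPreconnected
  have h1 : AnalyticOnNhd ℂ (fun w : ℂ => ∫ t in Set.Ioi (0 : ℝ),
      (t : ℂ) ^ (α - 1) * Complex.exp (-(w * t))) {z : ℂ | 0 < z.re} :=
    DifferentiableOn.analyticOnNhd (fun z hz =>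
      (differentiableAt_integral_cpow_mul_exp hα hz).differentiableWithinAt) hopen
  have h2 : AnalyticOnNhd ℂ (fun w : ℂ => w ^ (-α) * Complex.Gamma α) {z : ℂ | 0 < z.re} :=
    DifferentiableOn.analyticOnNhd (fun z hz => (((hasDerivAt_id z).cpow_const
      (Or.inl hz)).mul_const _).differentiableAt.differentiableWithinAt) hopen
  -- The formula is known for real `r > 0`; such points accumulate at `1`, so the identity theorem
  -- extends it to the half-plane.
  refine h1.eqOn_of_preconnected_of_frequently_eq h2 hconn (z₀ := 1) (by simp) ?_ hw
  have hmap : Tendsto (fun r : ℝ => (r : ℂ)) (𝓝[>] 1) (𝓝[≠] 1) := by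
    refine tendsto_nhdsWithin_iff.2 ⟨?_, ?_⟩
    · have := Complex.continuous_ofReal.tendsto 1
      rw [Complex.ofReal_one] at this
      exact this.mono_left nhdsWithin_le_nhds
    · filter_upwards [self_mem_nhdsWithin] with r hr
      exact fun h => (ne_of_gt (Set.mem_Ioi.1 hr)) (by simpa using h)
  refine hmap.frequently (Eventually.frequently ?_)
  filter_upwards [self_mem_nhdsWithin] with r hr
  have hr : 0 < r := zero_lt_one.trans hr
  rw [Complex.integral_cpow_mul_exp_neg_mul_Ioi hα hr, one_div, Complex.inv_cpow _ _ (by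
    rw [Complex.arg_ofReal_of_nonneg hr.le]; exact Real.pi_pos.ne), Complex.cpow_neg]

lemma integrable_vertical_cpow_neg {a s : ℝ} (ha : 0 < a) (hs : 1 < s) :
    Integrable (fun y : ℝ => (a + y * Complex.I : ℂ) ^ (-(s : ℂ))) := by
  have hline : Continuous (fun y : ℝ => (a + y * Complex.I : ℂ) ^ (-(s : ℂ))) := by
    refine continuous_iff_continuousAt.2 fun y =>
      ContinuousAt.cpow (by fun_prop) continuousAt_const (Or.inl (by simpa using ha))
  have hnorm : ∀ y : ℝ, ‖(a + y * Complex.I : ℂ) ^ (-(s : ℂ))‖ ≤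
      (min a 1 / 2) ^ (-s) * (1 + ‖y‖) ^ (-s) := by
    intro y
    have h1 : (min a 1 / 2) * (1 + ‖y‖) ≤ ‖(a + y * Complex.I : ℂ)‖ := by
      have h2 := Complex.abs_re_le_norm (a + y * Complex.I : ℂ)
      have h3 := Complex.abs_im_le_norm (a + y * Complex.I : ℂ)
      simp only [Complex.add_re, Complex.ofReal_re, Complex.mul_re, Complex.I_re, mul_zero,
        Complex.ofReal_im, Complex.I_im, mul_one, sub_self, add_zero, Complex.add_im,
        Complex.mul_im, zero_add, abs_of_pos ha] at h2 h3
      rw [Real.norm_eq_abs]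
      nlinarith [min_le_left a 1, min_le_right a 1, abs_nonneg y]
    have h4 : 0 < min a 1 / 2 := by positivity
    rw [show -(s : ℂ) = ((-s : ℝ) : ℂ) by push_cast; rfl, Complex.norm_cpow_real,
      ← Real.mul_rpow h4.le (by positivity)]
    exact Real.rpow_le_rpow_of_nonpos (by positivity) h1 (by linarith)
  exact ((integrable_one_add_norm (E := ℝ) (r := s) (by simpa using hs)).const_mul _).mono'
    hline.aestronglyMeasurable (Eventually.of_forall hnorm)

open FourierTransform in
/-- The inverse Laplace transform of `z ^ (-s)`. -/
lemma integral_exp_mul_cpow_neg {a s : ℝ} (ha : 0 < a) (hs : 1 < s) (c : ℝ) :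
    ∫ y : ℝ, Complex.exp (c * (a + y * Complex.I)) * (a + y * Complex.I) ^ (-(s : ℂ)) =
      2 * Real.pi * (((max c 0) ^ (s - 1) / Real.Gamma s : ℝ) : ℂ) := by
  -- Fourier inversion for `g`, whose transform at `ξ` is `Γ(s) (a + 2πiξ)^(-s)`. The condition `s >
  -- 1` makes `g` continuous at `0` and the transform integrable.
  set g : ℝ → ℂ := fun t => (((max t 0) ^ (s - 1) * Real.exp (-a * t) : ℝ) : ℂ)
  have hg : Continuous g := by
    refine Complex.continuous_ofReal.comp (Continuous.mul ?_ (by fun_prop))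
    exact Continuous.rpow_const (by fun_prop) fun _ => Or.inr (by linarith)
  have hzero : ∀ t ∉ Set.Ioi (0 : ℝ), g t = 0 := by
    intro t ht
    have : max t 0 = 0 := max_eq_right (not_lt.1 ht)
    simp [g, this, Real.zero_rpow (by linarith : s - 1 ≠ 0)]
  have hgi : Integrable g := by
    refine (integrableOn_iff_integrable_of_support_subset (s := Set.Ioi 0) ?_).1 ?_
    · intro t ht
      by_contra h
      exact ht (hzero t h)
    · refine IntegrableOn.congr_fun (f := fun t : ℝ => ((t ^ (s - 1) * Real.exp (-a * t) : ℝ) : ℂ))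
        (integrableOn_rpow_mul_exp_neg_mul (by linarith) ha).ofReal ?_ measurableSet_Ioi
      intro t ht
      simp [g, max_eq_left (Set.mem_Ioi.1 ht).le]
  have hF : ∀ ξ : ℝ, 𝓕 g ξ =
      (a + (2 * Real.pi * ξ : ℝ) * Complex.I) ^ (-(s : ℂ)) * Complex.Gamma s := by
    intro ξ
    rw [← integral_cpow_mul_exp_neg_mul (by simpa using by linarith) (by simpa using ha),
      Real.fourier_real_eq_integral_exp_smul, ← setIntegral_eq_integral_of_forall_compl_eq_zero
        (s := Set.Ioi 0) (fun t ht => by simp [hzero t ht])]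
    refine setIntegral_congr_fun measurableSet_Ioi fun t ht => ?_
    have ht : 0 < t := ht
    simp only [g, max_eq_left ht.le, smul_eq_mul]
    push_cast
    rw [Complex.ofReal_cpow ht.le, mul_left_comm, ← Complex.exp_add]
    push_cast
    congr 2
    ring
  have hli := integrable_vertical_cpow_neg ha hs
  have hFi : Integrable (𝓕 g) := by
    have := (hli.comp_mul_left' (by positivity : 2 * Real.pi ≠ 0)).mul_const (Complex.Gamma s)
    refine this.congr (Eventually.of_forall fun ξ => ?_)
    rw [hF]
  have hinv := congrFun (hg.fourierInv_fourier_eq hgi hFi) c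
  rw [Real.fourierInv_eq'] at hinv
  have hcomp := Measure.integral_comp_mul_left (fun y : ℝ => Complex.exp (c * (a + y * Complex.I)) *
    (a + y * Complex.I) ^ (-(s : ℂ))) (2 * Real.pi)
  have hΓ : Complex.Gamma s ≠ 0 := Complex.Gamma_ne_zero_of_re_pos (by simpa using by linarith)
  have hlhs : ∫ v : ℝ, Complex.exp ((2 * Real.pi * inner ℝ v c : ℝ) * Complex.I) • 𝓕 g v =
      Complex.Gamma s * Complex.exp (-(c * a)) * ∫ x : ℝ,
        Complex.exp (c * (a + (2 * Real.pi * x : ℝ) * Complex.I)) *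
          (a + (2 * Real.pi * x : ℝ) * Complex.I) ^ (-(s : ℂ)) := by
    rw [← integral_const_mul]
    congr 1
    ext v
    rw [hF, smul_eq_mul]
    have : Complex.exp ((2 * Real.pi * inner ℝ v c : ℝ) * Complex.I) = Complex.exp (-(c * a)) *
        Complex.exp (c * (a + (2 * Real.pi * v : ℝ) * Complex.I)) := by
      rw [← Complex.exp_add]
      congr 1
      simp only [RCLike.inner_apply, conj_trivial]
      push_cast
      ring
    rw [this]
    ring
  rw [hlhs, hcomp, abs_of_pos (by positivity)] at hinv
  simp only [g] at hinv
  have hexp : Complex.exp (-(c * a)) ≠ 0 := Complex.exp_ne_zero _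
  have hπ : (Real.pi : ℂ) ≠ 0 := by exact_mod_cast Real.pi_ne_zero
  rw [Complex.real_smul] at hinv
  push_cast at hinv ⊢
  rw [Complex.Gamma_ofReal] at hinv hΓ
  rw [show -(a : ℂ) * c = -(c * a) by ring] at hinv
  field_simp at hinv
  field_simp
  linear_combination hinv

/-! ### The common kernel of `H` and `I`: recursion and Euler representation. -/

noncomputable section

/-- The integrand `t^(α-1) e^(σt) (κ-σt)₊^(s-1)` of the Euler-type representation. -/
def eulerIntegrand (κ : ℝ) (α : ℂ) (σ s t : ℝ) : ℂ :=
  (t : ℂ) ^ (α - 1) * ((Real.exp (σ * t) * (max (κ - σ * t) 0) ^ (s - 1) : ℝ) : ℂ)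

/-- The integrand `e^(κz) (σ(z-1))^(-α) z^(-s)`; `σ = 1` gives the functions `H` and `σ = -1` the
functions `I`. -/
def loopKernel (κ : ℝ) (α : ℂ) (σ s : ℝ) (z : ℂ) : ℂ :=
  Complex.exp (κ * z) * (σ * (z - 1)) ^ (-α) * z ^ (-(s : ℂ))

/-- In the application `κ = ρ/η`, `α = θ/η` and `s = n + 1 - m + m/η`, with `(σ, a) = (1, 2)` for
`H` and `(-1, 1/2)` for `I`. -/
def loopTransform (κ : ℝ) (α : ℂ) (σ a s : ℝ) : ℂ :=
  (2 * Real.pi * Complex.I)⁻¹ * loopIntegral a 2 (loopKernel κ α σ s)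

end

/-- A loop of `loopIntegral a 2` together with the region between it and the line `Re z = a`. -/
def loopDomain (a : ℝ) : Set ℂ := {z | z.re ≤ a ∧ (2 ≤ |z.im| ∨ z.re = a)}

lemma loopSet_subset_loopDomain (a : ℝ) : loopSet a 2 ⊆ loopDomain a := by
  rintro z (⟨h1, h2 | h2⟩ | ⟨h1, -⟩)
  · exact ⟨h1, Or.inl (by simp [h2])⟩
  · exact ⟨h1, Or.inl (by simp [h2])⟩
  · exact ⟨h1.le, Or.inr h1⟩

section kernel

variable {κ σ a : ℝ} {α : ℂ}

lemma half_le_norm_of_mem (ha : 1 / 2 ≤ a) {z : ℂ} (hz : z ∈ loopDomain a) : 1 / 2 ≤ ‖z‖ := by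
  rcases hz.2 with h | h
  · exact (by linarith : (1 : ℝ) / 2 ≤ |z.im|).trans (Complex.abs_im_le_norm z)
  · exact (by linarith [le_abs_self z.re] : (1 : ℝ) / 2 ≤ |z.re|).trans (Complex.abs_re_le_norm z)

lemma mem_slitPlane_of_mem (ha : 1 / 2 ≤ a) {z : ℂ} (hz : z ∈ loopDomain a) :
    z ∈ Complex.slitPlane := by
  rcases hz.2 with h | h
  · exact Or.inr fun h0 => by norm_num [h0] at h
  · exact Or.inl (by linarith)

/-- The hypothesis `ha'` puts the line `Re z = a` on the side of `1` where `σ(z-1)` has positive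
real part, uniformly for both families. -/
lemma half_le_norm_sub_one_of_mem (hσ : |σ| = 1) (ha' : 1 / 2 ≤ σ * (a - 1)) {z : ℂ}
    (hz : z ∈ loopDomain a) : 1 / 2 ≤ ‖σ * (z - 1)‖ := by
  rcases hz.2 with h | h
  · refine le_trans ?_ (Complex.abs_im_le_norm _)
    simp [abs_mul, hσ]
    linarith
  · refine le_trans ?_ (Complex.abs_re_le_norm _)
    have : (σ * (z - 1) : ℂ).re = σ * (a - 1) := by simp [h]
    rw [this]
    exact ha'.trans (le_abs_self _)

lemma sub_one_mem_slitPlane_of_mem (hσ : |σ| = 1) (ha' : 1 / 2 ≤ σ * (a - 1)) {z : ℂ}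
    (hz : z ∈ loopDomain a) : σ * (z - 1) ∈ Complex.slitPlane := by
  have hσ0 : σ ≠ 0 := by rintro rfl; simp at hσ
  rcases hz.2 with h | h
  · refine Or.inr ?_
    simp only [Complex.mul_im, Complex.ofReal_re, Complex.sub_im, Complex.one_im, sub_zero,
      Complex.ofReal_im, zero_mul, add_zero]
    exact mul_ne_zero hσ0 fun h0 => by norm_num [h0] at h
  · refine Or.inl ?_
    simp [h]
    linarith

lemma loopKernel_sub_one {z : ℂ} (hz : z ≠ 0) (s : ℝ) :
    loopKernel κ α σ (s - 1) z = z * loopKernel κ α σ s z := by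
  simp only [loopKernel]
  rw [show -((s - 1 : ℝ) : ℂ) = -(s : ℂ) + 1 by push_cast; ring, Complex.cpow_add _ _ hz,
    Complex.cpow_one]
  ring

lemma hasDerivAt_loopKernel (hσ : |σ| = 1) (ha : 1 / 2 ≤ a) (ha' : 1 / 2 ≤ σ * (a - 1)) {z : ℂ}
    (hz : z ∈ loopDomain a) (s : ℝ) :
    HasDerivAt (loopKernel κ α σ s)
      (κ * loopKernel κ α σ s z - α * (loopKernel κ α σ s z / (z - 1))
        - s * loopKernel κ α σ (s + 1) z) z := by
  have hz1 := mem_slitPlane_of_mem ha hz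
  have hz2 := sub_one_mem_slitPlane_of_mem hσ ha' hz
  have hz0 : z ≠ 0 := Complex.slitPlane_ne_zero hz1
  have hw0 := Complex.slitPlane_ne_zero hz2
  have hσ0 : (σ : ℂ) ≠ 0 := left_ne_zero_of_mul hw0
  have hz10 : z - 1 ≠ 0 := right_ne_zero_of_mul hw0
  have h1 : HasDerivAt (fun z : ℂ => Complex.exp (κ * z)) _ z :=
    ((hasDerivAt_id z).const_mul (κ : ℂ)).cexp
  have h2 : HasDerivAt (fun z : ℂ => (σ * (z - 1) : ℂ) ^ (-α)) _ z :=
    (((hasDerivAt_id z).sub_const (1 : ℂ)).const_mul (σ : ℂ)).cpow_const hz2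
  have h3 : HasDerivAt (fun z : ℂ => z ^ (-(s : ℂ))) _ z := (hasDerivAt_id z).cpow_const hz1
  refine ((h1.mul h2).mul h3).congr_deriv ?_
  have e1 : (σ * (z - 1) : ℂ) ^ (-α - 1) = (σ * (z - 1) : ℂ) ^ (-α) / (σ * (z - 1)) := by
    rw [Complex.cpow_sub _ _ hw0, Complex.cpow_one]
  have e2 : loopKernel κ α σ (s + 1) z = loopKernel κ α σ s z / z := by
    rw [eq_div_iff hz0, mul_comm, ← loopKernel_sub_one hz0, add_sub_cancel_right]
  have e3 : z ^ (-(s : ℂ) - 1) = z ^ (-(s : ℂ)) / z := by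
    rw [Complex.cpow_sub _ _ hz0, Complex.cpow_one]
  rw [e2]
  simp only [id, e1, e3, loopKernel, Pi.mul_apply]
  field_simp
  ring

lemma exists_norm_cpow_le (hσ : |σ| = 1) (ha' : 1 / 2 ≤ σ * (a - 1)) (hα : 0 < α.re) :
    ∃ M : ℝ, 0 ≤ M ∧ ∀ z ∈ loopDomain a, ‖(σ * (z - 1) : ℂ) ^ (-α)‖ ≤ M := by
  refine ⟨(1 / 2) ^ (-α.re) * Real.exp (Real.pi * |α.im|), by positivity, fun z hz => ?_⟩
  refine (Complex.norm_cpow_le _ _).trans ?_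
  rw [div_eq_mul_inv, ← Real.exp_neg, Complex.neg_re, Complex.neg_im]
  have h1 := half_le_norm_sub_one_of_mem hσ ha' hz
  have h2 := Real.rpow_le_rpow_of_nonpos (by norm_num) h1 (by linarith : -α.re ≤ 0)
  have h3 : -((σ * (z - 1) : ℂ).arg * -α.im) ≤ Real.pi * |α.im| := by
    rw [mul_neg, neg_neg]
    refine (le_abs_self _).trans ?_
    rw [abs_mul]
    have := Complex.abs_arg_le_pi (σ * (z - 1) : ℂ)
    gcongr
  have h4 := Real.exp_le_exp.2 h3
  gcongr

lemma exists_norm_loopKernel_le (hσ : |σ| = 1) (ha : 1 / 2 ≤ a) (ha' : 1 / 2 ≤ σ * (a - 1))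
    (hα : 0 < α.re) {s : ℝ} (hs : 0 ≤ s) :
    ∃ C : ℝ, ∀ z ∈ loopDomain a, ‖loopKernel κ α σ s z‖ ≤ C * Real.exp (κ * z.re) := by
  obtain ⟨M, hM0, hM⟩ := exists_norm_cpow_le (a := a) hσ ha' hα
  refine ⟨M * (1 / 2) ^ (-s), fun z hz => ?_⟩
  have h1 := hM z hz
  have h2 : ‖z ^ (-(s : ℂ))‖ ≤ (1 / 2) ^ (-s) := by
    rw [show -(s : ℂ) = ((-s : ℝ) : ℂ) by push_cast; rfl, Complex.norm_cpow_real]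
    exact Real.rpow_le_rpow_of_nonpos (by norm_num) (half_le_norm_of_mem ha hz) (by linarith)
  rw [loopKernel, norm_mul, norm_mul, Complex.norm_exp]
  simp only [Complex.mul_re, Complex.ofReal_re, Complex.ofReal_im, zero_mul, sub_zero]
  calc _ ≤ Real.exp (κ * z.re) * M * (1 / 2) ^ (-s) := by gcongr
    _ = _ := by ring

lemma exists_norm_loopKernel_le_im (hσ : |σ| = 1) (ha' : 1 / 2 ≤ σ * (a - 1))
    (hα : 0 < α.re) {s : ℝ} (hs : 0 ≤ s) :
    ∃ C : ℝ, 0 ≤ C ∧ ∀ z : ℂ, z.re ≤ a → 2 ≤ |z.im| →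
      ‖loopKernel κ α σ s z‖ ≤ C * Real.exp (κ * z.re) * |z.im| ^ (-s) := by
  obtain ⟨M, hM0, hM⟩ := exists_norm_cpow_le (a := a) hσ ha' hα
  refine ⟨M, hM0, fun z hz1 hz2 => ?_⟩
  have h1 := hM z ⟨hz1, Or.inl hz2⟩
  have h2 : ‖z ^ (-(s : ℂ))‖ ≤ |z.im| ^ (-s) := by
    rw [show -(s : ℂ) = ((-s : ℝ) : ℂ) by push_cast; rfl, Complex.norm_cpow_real]
    exact Real.rpow_le_rpow_of_nonpos (by linarith) (Complex.abs_im_le_norm z) (by linarith)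
  rw [loopKernel, norm_mul, norm_mul, Complex.norm_exp]
  simp only [Complex.mul_re, Complex.ofReal_re, Complex.ofReal_im, zero_mul, sub_zero]
  calc _ ≤ Real.exp (κ * z.re) * M * |z.im| ^ (-s) := by gcongr
    _ = _ := by ring

lemma loopIntegrable_loopKernel (hκ : 0 < κ) (hσ : |σ| = 1) (ha : 1 / 2 ≤ a)
    (ha' : 1 / 2 ≤ σ * (a - 1)) (hα : 0 < α.re) {s : ℝ} (hs : 0 ≤ s) :
    LoopIntegrable a 2 (loopKernel κ α σ s) := by
  obtain ⟨C, hC⟩ := exists_norm_loopKernel_le (κ := κ) hσ ha ha' hα hs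
  refine loopIntegrable_of_bound (by norm_num) hκ (fun z hz => ?_)
    (fun z hz => hC z (loopSet_subset_loopDomain a hz))
  exact (hasDerivAt_loopKernel hσ ha ha'
    (loopSet_subset_loopDomain a hz) s).continuousAt.continuousWithinAt

/-- The three-term recursion in `s`. -/
lemma loopTransform_recursion (hκ : 0 < κ) (hσ : |σ| = 1) (ha : 1 / 2 ≤ a)
    (ha' : 1 / 2 ≤ σ * (a - 1)) (hα : 0 < α.re) {s : ℝ} (hs : 1 ≤ s) :
    (κ + α + s - 1) * loopTransform κ α σ a s =
      κ * loopTransform κ α σ a (s - 1) + s * loopTransform κ α σ a (s + 1) := by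
  have hI : ∀ t : ℝ, 0 ≤ t → LoopIntegrable a 2 (loopKernel κ α σ t) :=
    fun t ht => loopIntegrable_loopKernel hκ hσ ha ha' hα ht
  have i1 := (hI (s - 1) (by linarith)).const_mul (κ : ℂ)
  have i2 := (hI s (by linarith)).const_mul (-(κ + α + s - 1))
  have i3 := (hI (s + 1) (by linarith)).const_mul (s : ℂ)
  obtain ⟨C₁, hC₁⟩ := exists_norm_loopKernel_le (κ := κ) hσ ha ha' hα (by linarith : 0 ≤ s - 1)
  obtain ⟨C₂, hC₂⟩ := exists_norm_loopKernel_le (κ := κ) hσ ha ha' hα (by linarith : 0 ≤ s)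
  -- The primitive is `(z-1)` times the kernel at `s`; this factor cancels the pole created by
  -- differentiating `(σ(z-1))^(-α)`.
  have key := loopIntegral_deriv_eq_zero (a := a) (ε := 2) (by norm_num)
    (g := fun z => loopKernel κ α σ (s - 1) z - loopKernel κ α σ s z) (C := C₁ + C₂) hκ
    (fun z hz => by
      have hz := loopSet_subset_loopDomain a hz
      refine ((hasDerivAt_loopKernel hσ ha ha' hz (s - 1)).sub
        (hasDerivAt_loopKernel hσ ha ha' hz s)).congr_deriv (g' := _) ?_
      have hz0 : z ≠ 0 := Complex.slitPlane_ne_zero (mem_slitPlane_of_mem ha hz)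
      have hz10 : z - 1 ≠ 0 := right_ne_zero_of_mul
        (Complex.slitPlane_ne_zero (sub_one_mem_slitPlane_of_mem hσ ha' hz))
      have e : loopKernel κ α σ (s - 1) z / (z - 1) =
          loopKernel κ α σ s z + loopKernel κ α σ s z / (z - 1) := by
        rw [loopKernel_sub_one hz0]
        field_simp
        ring
      rw [e, sub_add_cancel]
      show _ = κ * loopKernel κ α σ (s - 1) z + -(κ + α + s - 1) * loopKernel κ α σ s z
        + s * loopKernel κ α σ (s + 1) z
      push_cast
      ring)
    (fun z hz => by
      have hz := loopSet_subset_loopDomain a hz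
      refine (norm_sub_le _ _).trans ?_
      rw [add_mul]
      exact add_le_add (hC₁ z hz) (hC₂ z hz))
    ((i1.add i2).add i3)
  rw [loopIntegral_add (i1.add i2) i3, loopIntegral_add i1 i2, loopIntegral_const_mul,
    loopIntegral_const_mul, loopIntegral_const_mul] at key
  simp only [loopTransform]
  linear_combination -(2 * Real.pi * Complex.I)⁻¹ * key

lemma loopTransform_eq_integral_vertical (hκ : 0 < κ) (hσ : |σ| = 1) (ha : 1 / 2 ≤ a)
    (ha' : 1 / 2 ≤ σ * (a - 1)) (hα : 0 < α.re) {s : ℝ} (hs : 1 < s) :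
    loopTransform κ α σ a s =
      (2 * Real.pi : ℂ)⁻¹ * ∫ y : ℝ, loopKernel κ α σ s (a + y * Complex.I) := by
  obtain ⟨C, hC0, hC⟩ := exists_norm_loopKernel_le_im (κ := κ) (a := a) hσ ha' hα
    (by linarith : 0 ≤ s)
  rw [loopTransform, loopIntegral_eq_integral_vertical (by norm_num) hκ hC0 hs
    (fun z h1 h2 => (hasDerivAt_loopKernel hσ ha ha' ⟨h1, Or.inl h2⟩ s).differentiableAt)
    (fun z hz => (hasDerivAt_loopKernel hσ ha ha'
      (loopSet_subset_loopDomain a hz) s).differentiableAt) hC, mul_inv, mul_assoc,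
    inv_mul_cancel_left₀ Complex.I_ne_zero]

/-- Euler-type integral representation of the loop integrals. -/
lemma loopTransform_eq_integral (hκ : 0 < κ) (hσ : |σ| = 1) (ha : 1 / 2 ≤ a)
    (ha' : 1 / 2 ≤ σ * (a - 1)) (hα : 0 < α.re) {s : ℝ} (hs : 1 < s) :
    IntegrableOn (eulerIntegrand κ α σ s) (Set.Ioi 0) ∧
    loopTransform κ α σ a s = (Complex.Gamma α * Complex.Gamma s)⁻¹ *
      ∫ t in Set.Ioi (0 : ℝ), eulerIntegrand κ α σ s t := by
  rw [loopTransform_eq_integral_vertical hκ hσ ha ha' hα hs]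
  have hΓα : Complex.Gamma α ≠ 0 := Complex.Gamma_ne_zero_of_re_pos hα
  -- On the line, `Re σ(z-1) > 0`, so `(σ(z-1))^(-α)` is replaced by its Euler integral over `t`.
  -- After Fubini, the integral over `y` is the inverse Laplace transform of `z^(-s)` at `κ - σt`.
  set F : ℝ → ℝ → ℂ := fun y t => Complex.exp (κ * (a + y * Complex.I)) *
    (a + y * Complex.I) ^ (-(s : ℂ)) *
      ((t : ℂ) ^ (α - 1) * Complex.exp (-(σ * (a + y * Complex.I - 1) * t)))
  have hre : ∀ y : ℝ, (σ * (a + y * Complex.I - 1) : ℂ).re = σ * (a - 1) := by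
    intro y
    simp
  have h1 : ∀ y : ℝ, loopKernel κ α σ s (a + y * Complex.I) =
      (Complex.Gamma α)⁻¹ * ∫ t in Set.Ioi (0 : ℝ), F y t := by
    intro y
    simp only [F]
    rw [integral_const_mul, integral_cpow_mul_exp_neg_mul hα (by rw [hre]; linarith), loopKernel]
    field_simp
  have hint : Integrable (Function.uncurry F) (volume.prod (volume.restrict (Set.Ioi 0))) := by
    have hd : Integrable (fun p : ℝ × ℝ => (Real.exp (κ * a) *
        ‖((a : ℂ) + p.1 * Complex.I) ^ (-(s : ℂ))‖) *
          (p.2 ^ (α.re - 1) * Real.exp (-(σ * (a - 1)) * p.2)))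
        (volume.prod (volume.restrict (Set.Ioi 0))) :=
      (((integrable_vertical_cpow_neg (by linarith) hs).norm.const_mul _)).mul_prod
        (integrableOn_rpow_mul_exp_neg_mul hα (by linarith))
    refine hd.mono' ?_ ?_
    · refine Measurable.aestronglyMeasurable ?_
      simp only [F, Function.uncurry_def]
      fun_prop
    · have hae : ∀ᵐ p ∂((volume : Measure ℝ).prod (volume.restrict (Set.Ioi (0 : ℝ)))), 0 < p.2 :=
        Measure.quasiMeasurePreserving_snd.ae
          (p := fun t : ℝ => 0 < t) (ae_restrict_mem measurableSet_Ioi)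
      filter_upwards [hae] with p hp
      simp only [F, Function.uncurry_def]
      rw [norm_mul, norm_mul, norm_cpow_mul_exp _ _ hp, hre, Complex.norm_exp]
      simp
  have hswap := integral_integral_swap hint
  have h2 : ∀ t : ℝ, ∫ y : ℝ, F y t =
      2 * Real.pi * (Complex.Gamma s)⁻¹ * eulerIntegrand κ α σ s t := by
    intro t
    have h3 : ∀ y : ℝ, F y t = ((t : ℂ) ^ (α - 1) * Complex.exp (σ * t)) *
        (Complex.exp ((κ - σ * t : ℝ) * (a + y * Complex.I)) *
          (a + y * Complex.I) ^ (-(s : ℂ))) := by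
      intro y
      have : Complex.exp (κ * (a + y * Complex.I)) *
          Complex.exp (-(σ * (a + y * Complex.I - 1) * t)) = Complex.exp (σ * t) *
            Complex.exp ((κ - σ * t : ℝ) * (a + y * Complex.I)) := by
        rw [← Complex.exp_add, ← Complex.exp_add]
        congr 1
        push_cast
        ring
      simp only [F]
      linear_combination (a + y * Complex.I) ^ (-(s : ℂ)) * (t : ℂ) ^ (α - 1) * this
    simp_rw [h3]
    rw [integral_const_mul, integral_exp_mul_cpow_neg (by linarith) hs, Complex.Gamma_ofReal,
      eulerIntegrand]
    push_cast
    ring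
  have hπ : (Real.pi : ℂ) ≠ 0 := by exact_mod_cast Real.pi_ne_zero
  have hΓs : Complex.Gamma s ≠ 0 :=
    Complex.Gamma_ne_zero_of_re_pos (by simpa using by linarith)
  constructor
  -- Fubini also yields integrability of the inner integral, hence of the Euler integrand.
  · have h4 := hint.integral_prod_right
    simp only [Function.uncurry_apply_pair, h2] at h4
    exact (integrable_const_mul_iff (IsUnit.mk0 _
      (mul_ne_zero (mul_ne_zero two_ne_zero hπ) (inv_ne_zero hΓs))) _).1 h4
  · simp_rw [h1]
    rw [integral_const_mul, hswap]
    simp_rw [h2]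
    rw [integral_const_mul]
    field_simp

end kernel

/-! ### The Casorati determinant of `I` and `H`, and the bound for `H`. -/

section wronskian

variable {κ : ℝ} {α : ℂ}

/-- The substitution `x = tu`, `q = (κ+t)(κ-u)` has Jacobian `-κ(t+u)` and maps the strip
bijectively to the quadrant. It is chosen because `x + q = κ(κ + t - u)` turns `e^(u-t)` into a
product of exponentials in `x` and `q`. -/
lemma integral_image_euler (hκ : 0 < κ) (f : ℝ × ℝ → ℂ) :
    ∫ p in Set.Ioi (0 : ℝ) ×ˢ Set.Ioi (0 : ℝ), f p =
      ∫ p in Set.Ioi (0 : ℝ) ×ˢ Set.Ioo (0 : ℝ) κ,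
        (κ * (p.1 + p.2)) • f (p.1 * p.2, (κ + p.1) * (κ - p.2)) := by
  set Φ : ℝ × ℝ → ℝ × ℝ := fun p => (p.1 * p.2, (κ + p.1) * (κ - p.2))
  set Φ' : ℝ × ℝ → ℝ × ℝ →L[ℝ] ℝ × ℝ := fun p =>
    (Matrix.toLin (.finTwoProd ℝ) (.finTwoProd ℝ)
      !![p.2, p.1; κ - p.2, -(κ + p.1)]).toContinuousLinearMap
  have hder : ∀ p : ℝ × ℝ, HasFDerivAt Φ (Φ' p) p := by
    intro p
    simp only [Φ']
    rw [Matrix.toLin_finTwoProd_toContinuousLinearMap]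
    refine HasFDerivAt.congr_fderiv (HasFDerivAt.prodMk (𝕜 := ℝ) (hasFDerivAt_fst.mul hasFDerivAt_snd)
      ((hasFDerivAt_fst.const_add κ).mul (hasFDerivAt_snd.const_sub κ))) ?_
    ext <;> simp
  have hdet : ∀ p : ℝ × ℝ, (Φ' p).det = -(κ * (p.1 + p.2)) := by
    intro p
    simp only [Φ', LinearMap.det_toContinuousLinearMap, LinearMap.det_toLin, Matrix.det_fin_two_of]
    ring
  have hinj : Set.InjOn Φ (Set.Ioi (0 : ℝ) ×ˢ Set.Ioo (0 : ℝ) κ) := by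
    rintro ⟨t, u⟩ ⟨ht, hu⟩ ⟨t', u'⟩ ⟨ht', hu'⟩ h
    simp only [Φ, Prod.mk.injEq, Set.mem_Ioi, Set.mem_Ioo] at h ht hu ht' hu' ⊢
    have h1 : κ * ((t - u) - (t' - u')) = 0 := by linear_combination h.1 + h.2
    have h2 : (t - u) - (t' - u') = 0 := (mul_eq_zero.1 h1).resolve_left hκ.ne'
    have h3 : (t - t') * (t' + u) = 0 := by linear_combination h.1 + t' * h2
    have h4 : t - t' = 0 := (mul_eq_zero.1 h3).resolve_right (by linarith)
    constructor <;> linarith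
  have himage : Φ '' (Set.Ioi (0 : ℝ) ×ˢ Set.Ioo (0 : ℝ) κ) =
      Set.Ioi (0 : ℝ) ×ˢ Set.Ioi (0 : ℝ) := by
    ext ⟨x, q⟩
    constructor
    · rintro ⟨⟨t, u⟩, ⟨ht, hu⟩, h⟩
      simp only [Φ, Prod.mk.injEq, Set.mem_Ioi, Set.mem_Ioo] at h ht hu
      refine ⟨?_, ?_⟩
      · simpa [← h.1] using mul_pos ht hu.1
      · simpa [← h.2] using mul_pos (by linarith : 0 < κ + t) (by linarith : 0 < κ - u)
    · rintro ⟨hx, hq⟩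
      simp only [Set.mem_Ioi] at hx hq
      -- `y` is `t - u`, so `t` and `-u` are the roots of `X² - yX - x`, and `r` is `t + u`.
      set y := (q + x - κ ^ 2) / κ
      have hy : κ * y = q + x - κ ^ 2 := by simp only [y]; field_simp
      have hr := Real.sq_sqrt (by positivity : 0 ≤ y ^ 2 + 4 * x)
      set r := √(y ^ 2 + 4 * x)
      have habs : |y| < r := by
        rw [← Real.sqrt_sq_eq_abs]
        exact Real.sqrt_lt_sqrt (sq_nonneg y) (by linarith)
      rw [abs_lt] at habs
      have hq' : (κ + (y + r) / 2) * (κ - (r - y) / 2) = q := by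
        linear_combination hy - hr / 4
      refine ⟨((y + r) / 2, (r - y) / 2), ⟨?_, ?_, ?_⟩, ?_⟩
      · simp only [Set.mem_Ioi]; linarith
      · show 0 < (r - y) / 2
        linarith
      · show (r - y) / 2 < κ
        rw [← hq'] at hq
        linarith [(mul_pos_iff_of_pos_left (by linarith : 0 < κ + (y + r) / 2)).1 hq]
      · simp only [Φ, Prod.mk.injEq]
        exact ⟨by linear_combination hr / 4, hq'⟩
  rw [← himage, integral_image_eq_integral_abs_det_fderiv_smul volume
    (measurableSet_Ioi.prod measurableSet_Ioo) (fun p _ => (hder p).hasFDerivWithinAt) hinj]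
  refine setIntegral_congr_fun (measurableSet_Ioi.prod measurableSet_Ioo) fun p hp => ?_
  have h1 : 0 < p.1 := hp.1
  have h2 : 0 < p.2 := hp.2.1
  simp only [hdet]
  rw [abs_neg, abs_of_pos (by positivity)]

lemma integral_cpow_mul_exp_neg_div (hκ : 0 < κ) {β : ℂ} (hβ : 0 < β.re) :
    ∫ t in Set.Ioi (0 : ℝ), (t : ℂ) ^ (β - 1) * Complex.exp (-t / κ) =
      (κ : ℂ) ^ β * Complex.Gamma β := by
  have := integral_cpow_mul_exp_neg_mul (w := (κ⁻¹ : ℝ)) hβ (by simpa using hκ)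
  have e : ((κ⁻¹ : ℝ) : ℂ) ^ (-β) = (κ : ℂ) ^ β := by
    rw [Complex.ofReal_inv, Complex.inv_cpow _ _ (by
      rw [Complex.arg_ofReal_of_nonneg hκ.le]; exact Real.pi_pos.ne), Complex.cpow_neg, inv_inv]
  rw [e] at this
  rw [← this]
  congr 1
  ext t
  congr 2
  push_cast
  field_simp

/-- The difference of the two products leaves the factor `(κ+t) - (κ-u) = t + u`, which is exactly
what the Jacobian supplies. -/
lemma euler_wronskian_aux (hκ : 0 < κ) {t u : ℝ} (s : ℝ) (ht : 0 < t) (hu : 0 < u)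
    (huκ : u < κ) :
    eulerIntegrand κ α (-1) s t * eulerIntegrand κ α 1 (s - 1) u
        - eulerIntegrand κ α (-1) (s - 1) t * eulerIntegrand κ α 1 s u =
      Complex.exp κ / κ * ((κ * (t + u)) • ((((t * u : ℝ) : ℂ) ^ (α - 1)
        * Complex.exp (-(t * u : ℝ) / κ)) * ((((κ + t) * (κ - u) : ℝ) : ℂ) ^ ((s - 1 : ℝ) - 1 : ℂ)
          * Complex.exp (-((κ + t) * (κ - u) : ℝ) / κ)))) := by
  have h1 : 0 < κ + t := by linarith
  have h2 : 0 < κ - u := by linarith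
  have e1 : (κ + t) ^ (s - 1) = (κ + t) ^ (s - 1 - 1) * (κ + t) := by
    rw [← Real.rpow_add_one h1.ne']
    congr 1
    ring
  have e2 : (κ - u) ^ (s - 1) = (κ - u) ^ (s - 1 - 1) * (κ - u) := by
    rw [← Real.rpow_add_one h2.ne']
    congr 1
    ring
  have e3 : (((κ + t) * (κ - u) : ℝ) : ℂ) ^ ((s - 1 : ℝ) - 1 : ℂ) =
      (((κ + t) ^ (s - 1 - 1) * (κ - u) ^ (s - 1 - 1) : ℝ) : ℂ) := by
    rw [← Real.mul_rpow h1.le h2.le, Complex.ofReal_cpow (by positivity)]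
    push_cast
    rfl
  have e4 : ((t * u : ℝ) : ℂ) ^ (α - 1) = (t : ℂ) ^ (α - 1) * (u : ℂ) ^ (α - 1) := by
    rw [Complex.ofReal_mul, Complex.mul_cpow_ofReal_nonneg ht.le hu.le]
  have hκ0 : (κ : ℂ) ≠ 0 := by exact_mod_cast hκ.ne'
  have e5 : Complex.exp κ * (Complex.exp (-(t * u : ℝ) / κ) *
      Complex.exp (-((κ + t) * (κ - u) : ℝ) / κ)) = Complex.exp (-t) * Complex.exp u := by
    rw [← Complex.exp_add, ← Complex.exp_add, ← Complex.exp_add]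
    congr 1
    push_cast
    field_simp
    ring
  generalize Complex.exp (-(t * u : ℝ) / κ) = E₁ at e5 ⊢
  generalize Complex.exp (-((κ + t) * (κ - u) : ℝ) / κ) = E₂ at e5 ⊢
  simp only [eulerIntegrand, neg_mul, one_mul, sub_neg_eq_add]
  rw [max_eq_left h1.le, max_eq_left h2.le, e1, e2, e3, e4, Complex.real_smul]
  push_cast
  field_simp
  linear_combination -((t : ℂ) ^ (α - 1) * (u : ℂ) ^ (α - 1) *
    (((κ + t) ^ (s - 1 - 1) : ℝ) : ℂ) * (((κ - u) ^ (s - 1 - 1) : ℝ) : ℂ) * (t + u)) * e5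

lemma eulerIntegrand_one_eq_zero {s u : ℝ} (hs : 1 < s) (hu : κ ≤ u) :
    eulerIntegrand κ α 1 s u = 0 := by
  rw [eulerIntegrand, one_mul, max_eq_right (by linarith), Real.zero_rpow (by linarith)]
  simp

lemma euler_wronskian (hκ : 0 < κ) (hα : 0 < α.re) {s : ℝ} (hs : 2 < s)
    (hI : ∀ σ : ℝ, σ = 1 ∨ σ = -1 → ∀ s, 1 < s →
      IntegrableOn (eulerIntegrand κ α σ s) (Set.Ioi 0)) :
    (∫ t in Set.Ioi (0 : ℝ), eulerIntegrand κ α (-1) s t) *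
        (∫ u in Set.Ioi (0 : ℝ), eulerIntegrand κ α 1 (s - 1) u)
      - (∫ t in Set.Ioi (0 : ℝ), eulerIntegrand κ α (-1) (s - 1) t) *
        (∫ u in Set.Ioi (0 : ℝ), eulerIntegrand κ α 1 s u) =
      Complex.exp κ / κ * (((κ : ℂ) ^ α * Complex.Gamma α)
        * ((κ : ℂ) ^ ((s - 1 : ℝ) : ℂ) * Complex.Gamma (s - 1 : ℝ))) := by
  have i1 := (hI (-1) (Or.inr rfl) s (by linarith)).mul_prod (hI 1 (Or.inl rfl) (s - 1) (by linarith))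
  have i2 := (hI (-1) (Or.inr rfl) (s - 1) (by linarith)).mul_prod (hI 1 (Or.inl rfl) s (by linarith))
  rw [← integral_prod_mul, ← integral_prod_mul, ← integral_sub i1 i2,
    ← integral_cpow_mul_exp_neg_div hκ hα,
    ← integral_cpow_mul_exp_neg_div hκ (β := ((s - 1 : ℝ) : ℂ)) (by simpa using by linarith),
    ← setIntegral_prod_mul, Measure.prod_restrict, ← Measure.volume_eq_prod,
    integral_image_euler hκ (f := fun p => ((p.1 : ℂ) ^ (α - 1) * Complex.exp (-p.1 / κ)) *
      ((p.2 : ℂ) ^ ((s - 1 : ℝ) - 1 : ℂ) * Complex.exp (-p.2 / κ))), ← integral_const_mul]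
  -- The integrands with `σ = 1` vanish for `u ≥ κ`, which reduces the quadrant to the strip.
  rw [setIntegral_eq_of_subset_of_forall_sdiff_eq_zero
    (measurableSet_Ioi.prod measurableSet_Ioi)
    (Set.prod_mono_right Set.Ioo_subset_Ioi_self : Set.Ioi (0 : ℝ) ×ˢ Set.Ioo (0 : ℝ) κ ⊆ _)]
  · refine setIntegral_congr_fun (measurableSet_Ioi.prod measurableSet_Ioo) fun p hp => ?_
    exact euler_wronskian_aux hκ s hp.1 hp.2.1 hp.2.2
  · rintro ⟨t, u⟩ ⟨⟨ht, hu⟩, hn⟩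
    have hu' : κ ≤ u := by
      by_contra h
      exact hn ⟨ht, hu, not_le.1 h⟩
    simp only [eulerIntegrand_one_eq_zero (by linarith : 1 < s) hu',
      eulerIntegrand_one_eq_zero (by linarith : 1 < s - 1) hu', mul_zero, sub_zero]

/-- The Casorati determinant of the two families of loop integrals. -/
lemma loopTransform_wronskian (hκ : 0 < κ) (hα : 0 < α.re) {s : ℝ} (hs : 2 < s) :
    loopTransform κ α (-1) (1 / 2) s * loopTransform κ α 1 2 (s - 1)
        - loopTransform κ α 1 2 s * loopTransform κ α (-1) (1 / 2) (s - 1) =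
      Complex.exp κ * (κ : ℂ) ^ (α + s - 2) / (Complex.Gamma α * Complex.Gamma s) := by
  have hH : ∀ s : ℝ, 1 < s → _ := fun s hs => loopTransform_eq_integral (κ := κ) (α := α) (σ := 1)
    (a := 2) (s := s) hκ (by simp) (by norm_num) (by norm_num) hα hs
  have hIm : ∀ s : ℝ, 1 < s → _ := fun s hs => loopTransform_eq_integral (κ := κ) (α := α)
    (σ := -1) (a := 1 / 2) (s := s) hκ (by simp) (by norm_num) (by norm_num) hα hs
  have key := euler_wronskian hκ hα hs (by
    rintro σ (rfl | rfl) s hs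
    · exact (hH s hs).1
    · exact (hIm s hs).1)
  rw [(hH s (by linarith)).2, (hH (s - 1) (by linarith)).2, (hIm s (by linarith)).2,
    (hIm (s - 1) (by linarith)).2]
  have hΓα : Complex.Gamma α ≠ 0 := Complex.Gamma_ne_zero_of_re_pos hα
  have hΓs : Complex.Gamma s ≠ 0 :=
    Complex.Gamma_ne_zero_of_re_pos (by simpa using by linarith)
  have hΓs' : Complex.Gamma (s - 1 : ℝ) ≠ 0 :=
    Complex.Gamma_ne_zero_of_re_pos (by simpa using by linarith)
  have hκ0 : (κ : ℂ) ≠ 0 := by exact_mod_cast hκ.ne'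
  have hpow : (κ : ℂ) ^ α * (κ : ℂ) ^ ((s - 1 : ℝ) : ℂ) = κ * (κ : ℂ) ^ (α + s - 2) := by
    rw [← Complex.cpow_add _ _ hκ0, show α + ((s - 1 : ℝ) : ℂ) = 1 + (α + s - 2) by push_cast; ring,
      Complex.cpow_add _ _ hκ0, Complex.cpow_one]
  have key' : _ = Complex.exp κ / κ * (κ * (κ : ℂ) ^ (α + s - 2)) * (Complex.Gamma α *
    Complex.Gamma (s - 1 : ℝ)) := key.trans (by rw [← hpow]; ring)
  field_simp
  field_simp at key'
  linear_combination key'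

/-- `H(s) Γ(s) κ^(-s)` stays bounded as `s → ∞`. -/
lemma exists_norm_loopTransform_le (hκ : 0 < κ) (hα : 0 < α.re) :
    ∃ C : ℝ, ∀ s : ℝ, 2 ≤ s →
      ‖Complex.Gamma s * (κ : ℂ) ^ (-(s : ℂ)) * loopTransform κ α 1 2 s‖ ≤ C := by
  have hH : ∀ s : ℝ, 1 < s → _ := fun s hs => loopTransform_eq_integral (κ := κ) (α := α) (σ := 1)
    (a := 2) (s := s) hκ (by simp) (by norm_num) (by norm_num) hα hs
  have h2 := (hH 2 (by norm_num)).1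
  refine ⟨‖Complex.Gamma α‖⁻¹ * (κ ^ (-2 : ℝ) *
    ∫ t in Set.Ioi (0 : ℝ), ‖eulerIntegrand κ α 1 2 t‖), fun s hs => ?_⟩
  have hΓs : Complex.Gamma s ≠ 0 :=
    Complex.Gamma_ne_zero_of_re_pos (by simpa using by linarith)
  -- On `(0, κ)` the extra factor `(κ-t)^(s-2)` is at most `κ^(s-2)`, so the integral at `s = 2`
  -- dominates all others.
  have hpt : ∀ t ∈ Set.Ioi (0 : ℝ), ‖eulerIntegrand κ α 1 s t‖ ≤
      κ ^ (s - 2) * ‖eulerIntegrand κ α 1 2 t‖ := by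
    intro t ht
    have ht : 0 < t := ht
    rcases le_or_gt κ t with h | h
    · rw [eulerIntegrand_one_eq_zero (by linarith) h, eulerIntegrand_one_eq_zero (by linarith) h]
      simp
    · have e : (κ - t) ^ (s - 1) = (κ - t) ^ (s - 2) * (κ - t) ^ ((2 : ℝ) - 1) := by
        rw [← Real.rpow_add (by linarith)]
        congr 1
        ring
      have h3 : (κ - t) ^ (s - 2) ≤ κ ^ (s - 2) :=
        Real.rpow_le_rpow (by linarith) (by linarith) (by linarith)
      have h4 : eulerIntegrand κ α 1 s t = (((κ - t) ^ (s - 2) : ℝ) : ℂ) *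
          eulerIntegrand κ α 1 2 t := by
        simp only [eulerIntegrand, one_mul]
        rw [max_eq_left (by linarith), e]
        push_cast
        ring
      rw [h4, norm_mul, Complex.norm_real,
        Real.norm_of_nonneg (Real.rpow_nonneg (by linarith) _)]
      gcongr
  have hint : ‖∫ t in Set.Ioi (0 : ℝ), eulerIntegrand κ α 1 s t‖ ≤
      κ ^ (s - 2) * ∫ t in Set.Ioi (0 : ℝ), ‖eulerIntegrand κ α 1 2 t‖ := by
    rw [← integral_const_mul]
    refine norm_integral_le_of_norm_le (h2.norm.const_mul _) ?_
    filter_upwards [ae_restrict_mem measurableSet_Ioi] with t ht using hpt t ht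
  rw [(hH s (by linarith)).2]
  have e1 : Complex.Gamma s * (κ : ℂ) ^ (-(s : ℂ)) * ((Complex.Gamma α * Complex.Gamma s)⁻¹ *
      ∫ t in Set.Ioi (0 : ℝ), eulerIntegrand κ α 1 s t) = (Complex.Gamma α)⁻¹ *
        ((κ : ℂ) ^ (-(s : ℂ)) * ∫ t in Set.Ioi (0 : ℝ), eulerIntegrand κ α 1 s t) := by
    field_simp
  rw [e1, norm_mul, norm_mul, norm_inv, Complex.norm_cpow_eq_rpow_re_of_pos hκ]
  have e2 : κ ^ (-2 : ℝ) = κ ^ (-s) * κ ^ (s - 2) := by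
    rw [← Real.rpow_add hκ]
    congr 1
    ring
  rw [e2, mul_assoc (κ ^ (-s))]
  simp only [Complex.neg_re, Complex.ofReal_re]
  gcongr

end wronskian

/-! ### Translation to `F`, `H`, `I` and their recursions. -/

lemma integrand_eq_loopKernel {ρ η σ : ℝ} (m : ℕ) (θ : ℂ) (n : ℤ) {z : ℂ} (hz : z ≠ 0) :
    Complex.exp (ρ * z / η) /
      ((σ * (z - 1)) ^ (θ / η) * z ^ (n + 1 - (m : ℤ)) * z ^ ((m : ℂ) / η)) =
    loopKernel (ρ / η) (θ / η) σ (n + 1 - m + m / η) z := by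
  have e : z ^ (-(((n + 1 - m + m / η : ℝ)) : ℂ)) =
      (z ^ (n + 1 - (m : ℤ)) * z ^ ((m : ℂ) / η))⁻¹ := by
    rw [Complex.cpow_neg, ← Complex.cpow_intCast, ← Complex.cpow_add _ _ hz]
    push_cast
    rfl
  rw [loopKernel, e, Complex.cpow_neg, div_eq_mul_inv, mul_assoc (_ ^ (θ / (η : ℂ))), mul_inv,
    ← mul_assoc]
  congr 3
  push_cast
  ring

lemma ne_zero_of_mem_loopSet {a : ℝ} (ha : 1 / 2 ≤ a) {z : ℂ} (hz : z ∈ loopSet a 2) : z ≠ 0 :=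
  Complex.slitPlane_ne_zero (mem_slitPlane_of_mem ha (loopSet_subset_loopDomain a hz))

lemma erlangH_eq (ρ η : ℝ) (m : ℕ) (θ : ℂ) (n : ℤ) :
    erlangH ρ η m θ n = loopTransform (ρ / η) (θ / η) 1 2 (n + 1 - m + m / η) := by
  rw [erlangH, loopTransform]
  congr 1
  refine loopIntegral_congr (by norm_num) fun z hz => ?_
  simpa using integrand_eq_loopKernel (ρ := ρ) (η := η) (σ := 1) m θ n
    (ne_zero_of_mem_loopSet (by norm_num) hz)

lemma erlangI_eq (ρ η : ℝ) (m : ℕ) (θ : ℂ) (n : ℤ) :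
    erlangI ρ η m θ n = loopTransform (ρ / η) (θ / η) (-1) (1 / 2) (n + 1 - m + m / η) := by
  rw [erlangI, loopTransform]
  congr 1
  refine loopIntegral_congr (by norm_num) fun z hz => ?_
  simpa using integrand_eq_loopKernel (ρ := ρ) (η := η) (σ := -1) m θ n
    (ne_zero_of_mem_loopSet le_rfl hz)

/-- By `Γ(s+1) = sΓ(s)`, the closed form obeys the same first-order relation that the recursions
impose on the determinant. -/
lemma Gamma_wronskian_step {κ : ℝ} {α : ℂ} (hκ : 0 < κ) {s : ℝ} (hs : 1 ≤ s) :
    s * (Complex.exp κ * (κ : ℂ) ^ (α + (s + 1 : ℝ) - 2) /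
        (Complex.Gamma α * Complex.Gamma (s + 1 : ℝ))) =
      κ * (Complex.exp κ * (κ : ℂ) ^ (α + s - 2) / (Complex.Gamma α * Complex.Gamma s)) := by
  have hs0 : (s : ℂ) ≠ 0 := by exact_mod_cast (by linarith : s ≠ 0)
  have hκ0 : (κ : ℂ) ≠ 0 := by exact_mod_cast hκ.ne'
  rw [show α + ((s + 1 : ℝ) : ℂ) - 2 = 1 + (α + s - 2) by push_cast; ring,
    Complex.cpow_add _ _ hκ0, Complex.cpow_one, Complex.ofReal_add, Complex.ofReal_one,
    Complex.Gamma_add_one _ hs0]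
  field_simp

/-- `loopTransform_wronskian` extended to `1 ≤ s` by the recursion. -/
lemma loopTransform_wronskian_of_one_le {κ : ℝ} {α : ℂ} (hκ : 0 < κ) (hα : 0 < α.re) {s : ℝ}
    (hs : 1 ≤ s) :
    loopTransform κ α (-1) (1 / 2) s * loopTransform κ α 1 2 (s - 1)
        - loopTransform κ α 1 2 s * loopTransform κ α (-1) (1 / 2) (s - 1) =
      Complex.exp κ * (κ : ℂ) ^ (α + s - 2) / (Complex.Gamma α * Complex.Gamma s) := by
  have hκ0 : (κ : ℂ) ≠ 0 := by exact_mod_cast hκ.ne'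
  have down : ∀ s : ℝ, 1 ≤ s →
      loopTransform κ α (-1) (1 / 2) (s + 1) * loopTransform κ α 1 2 (s + 1 - 1)
        - loopTransform κ α 1 2 (s + 1) * loopTransform κ α (-1) (1 / 2) (s + 1 - 1) =
        Complex.exp κ * (κ : ℂ) ^ (α + (s + 1 : ℝ) - 2) /
          (Complex.Gamma α * Complex.Gamma (s + 1 : ℝ)) →
      loopTransform κ α (-1) (1 / 2) s * loopTransform κ α 1 2 (s - 1)
        - loopTransform κ α 1 2 s * loopTransform κ α (-1) (1 / 2) (s - 1) =
        Complex.exp κ * (κ : ℂ) ^ (α + s - 2) / (Complex.Gamma α * Complex.Gamma s) := by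
    intro s hs h
    have rH := loopTransform_recursion (κ := κ) (α := α) (σ := 1) (a := 2) hκ (by simp)
      (by norm_num) (by norm_num) hα hs
    have rI := loopTransform_recursion (κ := κ) (α := α) (σ := -1) (a := 1 / 2) hκ (by simp)
      (by norm_num) (by norm_num) hα hs
    refine mul_left_cancel₀ hκ0 ?_
    rw [← Gamma_wronskian_step hκ hs, ← h, add_sub_cancel_right]
    linear_combination loopTransform κ α 1 2 s * rI - loopTransform κ α (-1) (1 / 2) s * rH
  -- The Euler representation at `s - 1` needs `s > 2`; from `s ≥ 1` two steps up reach that range.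
  refine down s hs (down (s + 1) (by linarith) ?_)
  exact loopTransform_wronskian hκ hα (by linarith)

section erlang

variable {ρ η : ℝ} {m : ℕ} {θ : ℂ}

lemma re_div_pos (hη : 0 < η) (hθ : 0 < θ.re) : 0 < (θ / η : ℂ).re := by
  rw [Complex.div_ofReal_re]
  exact div_pos hθ hη

lemma erlangDeathRate_of_le {n : ℕ} (h : m ≤ n) :
    erlangDeathRate m η n = m + ((n : ℝ) - m) * η := by
  rw [erlangDeathRate]
  split_ifs with h1
  · obtain rfl : n = m := le_antisymm h1 h
    simp
  · rfl

lemma erlangDeathRate_pos (hη : 0 < η) (n : ℕ) : 0 < erlangDeathRate m η (n + 1) := by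
  rw [erlangDeathRate]
  split_ifs with h
  · positivity
  · have : (m : ℝ) < (n + 1 : ℕ) := by exact_mod_cast not_le.1 h
    have h2 := mul_pos (sub_pos.2 this) hη
    positivity

/-- Multiplication of the recursion by `η` turns `ηs` into the death rate in state `n + 1` and
`η(κ+α+s-1)` into `θ + ρ` plus the death rate in state `n`. This needs `n ≥ m`. -/
lemma recursion_of_eq_loopTransform (hρ : 0 < ρ) (hη : 0 < η) (hθ : 0 < θ.re) {σ a : ℝ}
    (hσ : |σ| = 1) (ha : 1 / 2 ≤ a) (ha' : 1 / 2 ≤ σ * (a - 1)) {X : ℤ → ℂ}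
    (hX : ∀ n, X n = loopTransform (ρ / η) (θ / η) σ a (n + 1 - m + m / η)) {n : ℕ} (hn : m ≤ n) :
    (θ + ρ + erlangDeathRate m η n) * X n =
      ρ * X (n - 1) + erlangDeathRate m η (n + 1) * X (n + 1) := by
  have hmn : (m : ℝ) ≤ n := by exact_mod_cast hn
  have hs : (1 : ℝ) ≤ n + 1 - m + m / η := by
    have : 0 ≤ (m : ℝ) / η := by positivity
    linarith
  have h := loopTransform_recursion (div_pos hρ hη) hσ ha ha' (re_div_pos hη hθ) hs
  rw [hX, hX, hX, erlangDeathRate_of_le hn, erlangDeathRate_of_le (by omega : m ≤ n + 1)]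
  push_cast at h ⊢
  rw [show (n : ℝ) + 1 - m + m / η - 1 = n - 1 + 1 - m + m / η by ring,
    show (n : ℝ) + 1 - m + m / η + 1 = n + 1 + 1 - m + m / η by ring] at h
  have hη0 : (η : ℂ) ≠ 0 := by exact_mod_cast hη.ne'
  generalize loopTransform (ρ / η) (θ / η) σ a (n + 1 - m + m / η) = X₀ at h ⊢
  generalize loopTransform (ρ / η) (θ / η) σ a (n - 1 + 1 - m + m / η) = X₁ at h ⊢
  generalize loopTransform (ρ / η) (θ / η) σ a (n + 1 + 1 - m + m / η) = X₂ at h ⊢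
  field_simp at h
  linear_combination h

lemma erlangH_recursion (hρ : 0 < ρ) (hη : 0 < η) (hθ : 0 < θ.re) {n : ℕ} (hn : m ≤ n) :
    (θ + ρ + erlangDeathRate m η n) * erlangH ρ η m θ n =
      ρ * erlangH ρ η m θ (n - 1) + erlangDeathRate m η (n + 1) * erlangH ρ η m θ (n + 1) :=
  recursion_of_eq_loopTransform hρ hη hθ (by simp) (by norm_num) (by norm_num)
    (erlangH_eq ρ η m θ) hn

lemma erlangI_recursion (hρ : 0 < ρ) (hη : 0 < η) (hθ : 0 < θ.re) {n : ℕ} (hn : m ≤ n) :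
    (θ + ρ + erlangDeathRate m η n) * erlangI ρ η m θ n =
      ρ * erlangI ρ η m θ (n - 1) + erlangDeathRate m η (n + 1) * erlangI ρ η m θ (n + 1) :=
  recursion_of_eq_loopTransform hρ hη hθ (by simp) (by norm_num) (by norm_num)
    (erlangI_eq ρ η m θ) hn

lemma erlang_wronskian (hρ : 0 < ρ) (hη : 0 < η) (hθ : 0 < θ.re) {n : ℕ} (hn : m ≤ n) :
    erlangI ρ η m θ n * erlangH ρ η m θ (n - 1) - erlangH ρ η m θ n * erlangI ρ η m θ (n - 1) =
      Complex.exp (ρ / η) * ((ρ / η : ℝ) : ℂ) ^ ((n : ℂ) - m - 1 + (θ + m) / η) /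
        (Complex.Gamma (θ / η) * Complex.Gamma ((n : ℂ) - m + 1 + m / η)) := by
  have hmn : (m : ℝ) ≤ n := by exact_mod_cast hn
  have hs : (1 : ℝ) ≤ n + 1 - m + m / η := by
    have : 0 ≤ (m : ℝ) / η := by positivity
    linarith
  have h := loopTransform_wronskian_of_one_le (div_pos hρ hη) (re_div_pos hη hθ) hs
  simp only [erlangH_eq, erlangI_eq]
  push_cast at h ⊢
  rw [show (n : ℝ) - 1 + 1 - m + m / η = n + 1 - m + m / η - 1 by ring, h,
    show (n : ℂ) + 1 - m + m / η = n - m + 1 + m / η by ring]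
  congr 3
  ring

/-- At `n = -1` the pole at `0` disappears. This is the boundary condition that selects `F` below
`m`. -/
lemma erlangF_neg_one (ρ : ℝ) (θ : ℂ) : erlangF ρ θ (-1) = 0 := by
  rw [erlangF]
  refine mul_eq_zero_of_right _ ?_
  refine Complex.circleIntegral_eq_zero_of_differentiable_on_off_countable (s := ∅) (by norm_num)
    Set.countable_empty ?_ ?_
  · intro z hz
    have hz1 : 1 - z ∈ Complex.slitPlane := by
      refine Or.inl ?_
      have := (Complex.re_le_norm z).trans (mem_closedBall_zero_iff.1 hz)
      simp only [Complex.sub_re, Complex.one_re]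
      linarith
    have h1 : ContinuousAt (fun z : ℂ => (1 - z) ^ θ) z :=
      ContinuousAt.cpow (by fun_prop) continuousAt_const hz1
    have h0 : (1 - z) ^ θ ≠ 0 := by
      simp [Complex.cpow_eq_zero_iff, Complex.slitPlane_ne_zero hz1]
    simp only [neg_add_cancel, zpow_zero, one_mul]
    exact (ContinuousAt.div (by fun_prop) h1 h0).continuousWithinAt
  · intro z hz
    have hz1 : 1 - z ∈ Complex.slitPlane := by
      refine Or.inl ?_
      have := (Complex.re_le_norm z).trans (mem_ball_zero_iff.1 hz.1).le
      simp only [Complex.sub_re, Complex.one_re]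
      linarith
    have h1 : DifferentiableAt ℂ (fun z : ℂ => (1 - z) ^ θ) z :=
      (((hasDerivAt_id z).const_sub 1).cpow_const hz1).differentiableAt
    have h0 : (1 - z) ^ θ ≠ 0 := by
      simp [Complex.cpow_eq_zero_iff, Complex.slitPlane_ne_zero hz1]
    simp only [neg_add_cancel, zpow_zero, one_mul]
    exact DifferentiableAt.div (by fun_prop) h1 h0

lemma erlangF_zero (ρ : ℝ) (θ : ℂ) : erlangF ρ θ 0 = 1 := by
  have hd : DiffContOnCl ℂ (fun z : ℂ => Complex.exp (ρ * z) / (1 - z) ^ θ) (Metric.ball 0 (1 / 2)) := by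
    refine DifferentiableOn.diffContOnCl fun z hz => ?_
    rw [closure_ball _ (by norm_num)] at hz
    have hz1 : 1 - z ∈ Complex.slitPlane := by
      refine Or.inl ?_
      have := (Complex.re_le_norm z).trans (mem_closedBall_zero_iff.1 hz)
      simp only [Complex.sub_re, Complex.one_re]
      linarith
    have h1 : DifferentiableAt ℂ (fun z : ℂ => (1 - z) ^ θ) z :=
      (((hasDerivAt_id z).const_sub 1).cpow_const hz1).differentiableAt
    have h0 : (1 - z) ^ θ ≠ 0 := by
      simp [Complex.cpow_eq_zero_iff, Complex.slitPlane_ne_zero hz1]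
    exact (DifferentiableAt.div (by fun_prop) h1 h0).differentiableWithinAt
  have := hd.two_pi_i_inv_smul_circleIntegral_sub_inv_smul (w := 0) (by simp)
  simp only [sub_zero, smul_eq_mul, mul_zero, Complex.exp_zero, Complex.one_cpow, div_one] at this
  rw [← this, erlangF]
  congr 2
  ext z
  simp only [zero_add, zpow_one]
  rw [div_mul_eq_div_div_swap, div_eq_inv_mul _ z]

lemma erlangF_recursion (ρ : ℝ) (θ : ℂ) (n : ℤ) :
    (θ + ρ + n) * erlangF ρ θ n = ρ * erlangF ρ θ (n - 1) + (n + 1) * erlangF ρ θ (n + 1) := by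
  set f : ℤ → ℂ → ℂ := fun n z => Complex.exp (ρ * z) / (z ^ (n + 1) * (1 - z) ^ θ)
  have hz0 : ∀ z ∈ Metric.sphere (0 : ℂ) (1 / 2), z ≠ 0 := by
    rintro z hz rfl
    norm_num at hz
  have hz1 : ∀ z ∈ Metric.sphere (0 : ℂ) (1 / 2), 1 - z ∈ Complex.slitPlane := by
    intro z hz
    refine Or.inl ?_
    have := (Complex.re_le_norm z).trans (mem_sphere_zero_iff_norm.1 hz).le
    simp only [Complex.sub_re, Complex.one_re]
    linarith
  have hpow : ∀ z ∈ Metric.sphere (0 : ℂ) (1 / 2), (1 - z) ^ θ ≠ 0 := by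
    intro z hz
    simp [Complex.cpow_eq_zero_iff, Complex.slitPlane_ne_zero (hz1 z hz)]
  have hd : ∀ n : ℤ, ∀ z ∈ Metric.sphere (0 : ℂ) (1 / 2), HasDerivAt (f n)
      (ρ * f n z + θ * (f n z / (1 - z)) - (n + 1) * f (n + 1) z) z := by
    intro n z hz
    have h0 := hz0 z hz
    have h10 := Complex.slitPlane_ne_zero (hz1 z hz)
    have h1 : HasDerivAt (fun z : ℂ => Complex.exp (ρ * z)) _ z :=
      ((hasDerivAt_id z).const_mul (ρ : ℂ)).cexp
    have h2 : HasDerivAt (fun z : ℂ => (1 - z) ^ θ) _ z :=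
      ((hasDerivAt_id z).const_sub 1).cpow_const (hz1 z hz)
    have h3 : HasDerivAt (fun z : ℂ => z ^ (n + 1)) _ z := hasDerivAt_zpow (n + 1) z (Or.inl h0)
    refine (h1.div (h3.mul h2) (mul_ne_zero (zpow_ne_zero _ h0) (hpow z hz))).congr_deriv ?_
    have e1 : (1 - z) ^ (θ - 1) = (1 - z) ^ θ / (1 - z) := by
      rw [Complex.cpow_sub _ _ h10, Complex.cpow_one]
    have e2 : z ^ (n + 1 + 1) = z ^ (n + 1) * z := zpow_add_one₀ h0 _
    have e3 : z ^ (n + 1 - 1) = z ^ (n + 1) / z := zpow_sub_one₀ h0 _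
    have hp := hpow z hz
    have hzp : z ^ (n + 1) ≠ 0 := zpow_ne_zero _ h0
    simp only [f, id, Pi.mul_apply, e1, e2, e3]
    generalize (1 - z) ^ θ = A at hp ⊢
    generalize z ^ (n + 1) = B at hzp ⊢
    push_cast
    field_simp
    ring
  have hci : ∀ n : ℤ, CircleIntegrable (f n) 0 (1 / 2) := fun n =>
    ContinuousOn.circleIntegrable (by norm_num)
      fun z hz => (hd n z hz).continuousAt.continuousWithinAt
  -- The primitive equals `(1-z) f n z`, so the pole at `1` cancels upon differentiation.
  have key := circleIntegral.integral_eq_zero_of_hasDerivWithinAt (c := 0) (R := 1 / 2)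
    (f := fun z => f n z - f (n - 1) z)
    (f' := fun z => (θ + ρ + n) * f n z - ρ * f (n - 1) z - (n + 1) * f (n + 1) z)
    (by norm_num) (fun z hz => by
      refine (((hd n z hz).sub (hd (n - 1) z hz)).congr_deriv ?_).hasDerivWithinAt
      have h0 := hz0 z hz
      have h10 := Complex.slitPlane_ne_zero (hz1 z hz)
      have e : f (n - 1) z = z * f n z := by
        simp only [f]
        rw [sub_add_cancel, zpow_add_one₀ h0]
        have hp := hpow z hz
        have hzp : z ^ n ≠ 0 := zpow_ne_zero _ h0
        field_simp
      rw [sub_add_cancel, e]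
      push_cast
      field_simp
      ring)
  have hcm : ∀ (c : ℂ) (n : ℤ), CircleIntegrable (fun z => c * f n z) 0 (1 / 2) :=
    fun c n => (hci n).const_smul (a := c)
  have hsub : CircleIntegrable (fun z => (θ + ρ + n) * f n z - ρ * f (n - 1) z) 0 (1 / 2) :=
    (hcm _ n).sub (hcm _ (n - 1))
  rw [circleIntegral.integral_sub hsub (hcm _ (n + 1)),
    circleIntegral.integral_sub (hcm _ n) (hcm _ (n - 1)), circleIntegral.integral_const_mul,
    circleIntegral.integral_const_mul, circleIntegral.integral_const_mul] at key
  simp only [erlangF]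
  linear_combination (2 * Real.pi * Complex.I)⁻¹ * key

end erlang

/-! ### Green functions of birth-death recursions. -/

section green

variable {ρ : ℝ} {mu : ℕ → ℝ} {θ : ℂ}

/-- The homogeneous forward equations, for a sequence whose index is shifted by one: `f (n + 1)`
is the value in state `n`. -/
def IsForwardAt (ρ : ℝ) (mu : ℕ → ℝ) (θ : ℂ) (f : ℕ → ℂ) (n : ℕ) : Prop :=
  (θ + ρ + mu n) * f (n + 1) = ρ * f n + mu (n + 1) * f (n + 2)

/-- The reciprocals of the reversible measure. -/
noncomputable def invWeight (ρ : ℝ) (mu : ℕ → ℝ) (n : ℕ) : ℝ :=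
  ∏ k ∈ Finset.range n, mu (k + 1) / ρ

lemma invWeight_succ (hρ : 0 < ρ) (n : ℕ) :
    ρ * (invWeight ρ mu (n + 1) : ℂ) = mu (n + 1) * invWeight ρ mu n := by
  have hρ0 : (ρ : ℂ) ≠ 0 := by exact_mod_cast hρ.ne'
  rw [invWeight, Finset.prod_range_succ, ← invWeight]
  push_cast
  field_simp

/-- As `ρ ≠ 0`, the recursion can be solved downwards. This continues `H` below `m`, where the death
rates have a different form. -/
lemma exists_forward_extension (hρ : 0 < ρ) (m : ℕ) :
    ∀ h : ℕ → ℂ, (∀ n, m ≤ n → IsForwardAt ρ mu θ h n) →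
      ∃ f : ℕ → ℂ, (∀ n, IsForwardAt ρ mu θ f n) ∧ ∀ n, m ≤ n → f n = h n := by
  have hρ0 : (ρ : ℂ) ≠ 0 := by exact_mod_cast hρ.ne'
  induction m with
  | zero => exact fun h hh => ⟨h, fun n => hh n n.zero_le, fun n _ => rfl⟩
  | succ m ih =>
    intro h hh
    set h' : ℕ → ℂ := Function.update h m
      (((θ + ρ + mu m) * h (m + 1) - mu (m + 1) * h (m + 2)) / ρ)
    have hne : ∀ n, m < n → h' n = h n := fun n hn => Function.update_of_ne hn.ne' _ _
    obtain ⟨f, hf, hfh⟩ := ih h' (by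
      intro n hn
      rcases hn.eq_or_lt with rfl | hlt
      · have e : h' m = ((θ + ρ + mu m) * h (m + 1) - mu (m + 1) * h (m + 2)) / ρ :=
          Function.update_self _ _ _
        rw [IsForwardAt, hne (m + 1) (by omega), hne (m + 2) (by omega), e]
        field_simp
        ring
      · rw [IsForwardAt, hne n hlt, hne (n + 1) (by omega), hne (n + 2) (by omega)]
        exact hh n hlt)
    exact ⟨f, hf, fun n hn => (hfh n (by omega)).trans (hne n hn)⟩

/-- Discrete Abel identity: one step of the recursion multiplies the Casoratian by `ρ / mu (n + 1)`,
which the weight undoes. -/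
lemma invWeight_mul_wronskian (hρ : 0 < ρ) {f g : ℕ → ℂ} (hf : ∀ n, IsForwardAt ρ mu θ f n)
    (hg : ∀ n, IsForwardAt ρ mu θ g n) (n : ℕ) :
    invWeight ρ mu n * (f (n + 1) * g n - g (n + 1) * f n) = f 1 * g 0 - g 1 * f 0 := by
  have hρ0 : (ρ : ℂ) ≠ 0 := by exact_mod_cast hρ.ne'
  induction n with
  | zero => simp [invWeight]
  | succ n ih =>
    rw [← ih]
    refine mul_left_cancel₀ hρ0 ?_
    have h1 := hf n
    have h2 := hg n
    have h3 := invWeight_succ (mu := mu) hρ n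
    rw [IsForwardAt] at h1 h2
    linear_combination (f (n + 2) * g (n + 1) - g (n + 2) * f (n + 1)) * h3
      + invWeight ρ mu n * f (n + 1) * h2 - invWeight ρ mu n * g (n + 1) * h1

/-- Reversibility: weighting turns the forward equation into the backward one. At `n = 0` the last
term is a remainder that vanishes only if `f 0 = 0`. -/
lemma forward_invWeight (hρ : 0 < ρ) {f : ℕ → ℂ} {n : ℕ} (hf : IsForwardAt ρ mu θ f n) :
    (θ + ρ + mu n) * (invWeight ρ mu n * f (n + 1)) =
      ρ * (invWeight ρ mu (n + 1) * f (n + 2)) + ρ * (invWeight ρ mu n * f n) := by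
  have h3 := invWeight_succ (mu := mu) hρ n
  rw [IsForwardAt] at hf
  linear_combination (invWeight ρ mu n : ℂ) * hf - f (n + 2) * h3

lemma exists_bound_of_eventually {u : ℕ → ℂ} {C : ℝ} {M : ℕ} (h : ∀ n, M ≤ n → ‖u n‖ ≤ C) :
    ∃ C : ℝ, ∀ n, ‖u n‖ ≤ C := by
  refine ⟨|C| + ∑ k ∈ Finset.range M, ‖u k‖, fun n => ?_⟩
  have hs : 0 ≤ ∑ k ∈ Finset.range M, ‖u k‖ := Finset.sum_nonneg fun _ _ => norm_nonneg _
  rcases le_or_gt M n with hn | hn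
  · linarith [h n hn, le_abs_self C]
  · have := Finset.single_le_sum (f := fun k => ‖u k‖) (fun _ _ => norm_nonneg _)
      (Finset.mem_range.2 hn)
    linarith [abs_nonneg C]

lemma forward_eq_zero_of_bounded (hρ : 0 < ρ) (hmu0 : mu 0 = 0) (hmu : ∀ n, 0 < mu (n + 1))
    (hθ : 0 < θ.re) {f : ℕ → ℂ} (hf : ∀ n, IsForwardAt ρ mu θ f n) (hf0 : f 0 = 0)
    {C : ℝ} (hC : ∀ n, ‖invWeight ρ mu n * f (n + 1)‖ ≤ C) (n : ℕ) : f (n + 1) = 0 := by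
  have hnonneg : ∀ n, 0 ≤ mu n := fun n => by
    rcases n with _ | n
    · exact hmu0.ge
    · exact (hmu n).le
  have hw : ∀ n, (invWeight ρ mu n : ℂ) ≠ 0 := fun n => by
    exact_mod_cast (Finset.prod_pos fun k _ => div_pos (hmu k) hρ).ne'
  have := eq_zero_of_bounded_backward hρ hnonneg hθ hC (fun n => by
    rw [forward_invWeight hρ (hf n)]
    congr 1
    rcases n with _ | n
    · simp [hmu0, hf0]
    · rw [Nat.add_sub_cancel]
      linear_combination f (n + 1) * invWeight_succ (mu := mu) hρ n) n
  exact (mul_eq_zero.1 this).resolve_left (hw n)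

/-- The bounded solution of the inhomogeneous backward equation is the Green function. -/
lemma eq_green_of_bounded (hρ : 0 < ρ) (hmu0 : mu 0 = 0) (hmu : ∀ n, 0 < mu (n + 1))
    (hθ : 0 < θ.re) {f g R : ℕ → ℂ} (hf : ∀ n, IsForwardAt ρ mu θ f n) (hf0 : f 0 = 0)
    (hg : ∀ n, IsForwardAt ρ mu θ g n) {C C' : ℝ} {M : ℕ}
    (hC : ∀ n, M ≤ n → ‖invWeight ρ mu n * g (n + 1)‖ ≤ C) {c : ℂ} (hc : c ≠ 0)
    (hfg : ∀ n, invWeight ρ mu n * (f (n + 1) * g n - g (n + 1) * f n) = c) (n : ℕ)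
    (hR : ∀ i, ‖R i‖ ≤ C')
    (hRn : ∀ i, (θ + ρ + mu i) * R i = ρ * R (i + 1) + mu i * R (i - 1) + if i = n then 1 else 0)
    (i : ℕ) : R i = invWeight ρ mu i * f (min i n + 1) * g (max i n + 1) / (ρ * c) := by
  have hρ0 : (ρ : ℂ) ≠ 0 := by exact_mod_cast hρ.ne'
  have hnonneg : ∀ n, 0 ≤ mu n := fun n => by
    rcases n with _ | n
    · exact hmu0.ge
    · exact (hmu n).le
  set u : ℕ → ℂ := fun i => invWeight ρ mu i * f (min i n + 1) * g (max i n + 1) / (ρ * c)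
  have hle : ∀ i, i ≤ n → u i = invWeight ρ mu i * f (i + 1) * (g (n + 1) / (ρ * c)) := by
    intro i hi
    simp only [u, min_eq_left hi, max_eq_right hi]
    ring
  have hge : ∀ i, n ≤ i → u i = invWeight ρ mu i * g (i + 1) * (f (n + 1) / (ρ * c)) := by
    intro i hi
    simp only [u, min_eq_right hi, max_eq_left hi]
    ring
  have hpred : ∀ h : ℕ → ℂ, ∀ i, (i = 0 → h 0 = 0) →
      mu i * (invWeight ρ mu (i - 1) * h (i - 1 + 1)) = ρ * (invWeight ρ mu i * h i) := by
    intro h i hi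
    rcases i with _ | i
    · simp [hmu0, hi]
    · rw [Nat.add_sub_cancel]
      linear_combination -h (i + 1) * invWeight_succ (mu := mu) hρ i
  have hu : ∀ i, (θ + ρ + mu i) * u i =
      ρ * u (i + 1) + mu i * u (i - 1) + if i = n then 1 else 0 := by
    intro i
    rcases lt_trichotomy i n with hlt | rfl | hgt
    · rw [hle i hlt.le, hle (i + 1) hlt, hle (i - 1) (by omega), if_neg hlt.ne]
      linear_combination (g (n + 1) / (ρ * c)) *
        (forward_invWeight hρ (hf i) - hpred f i fun _ => hf0)
    -- On the diagonal, `g` serves for `i` and `i + 1` and `f` for `i - 1`; the mismatch is the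
    -- weighted Casoratian `c`, normalised to the unit source.
    · rw [hge i le_rfl, hge (i + 1) (by omega), hle (i - 1) (by omega), if_pos rfl]
      have e1 := forward_invWeight hρ (hg i)
      have e2 := hpred f i fun _ => hf0
      have e3 := hfg i
      have e4 : ρ * c * (1 / (ρ * c)) = 1 := mul_one_div_cancel (mul_ne_zero hρ0 hc)
      linear_combination (f (i + 1) / (ρ * c)) * e1 - (g (i + 1) / (ρ * c)) * e2
        + (1 / (ρ * c)) * ρ * e3 + e4
    · rw [hge i hgt.le, hge (i + 1) (by omega), hge (i - 1) (by omega), if_neg hgt.ne']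
      linear_combination (f (n + 1) / (ρ * c)) *
        (forward_invWeight hρ (hg i) - hpred g i fun h => by omega)
  obtain ⟨B, hB⟩ := exists_bound_of_eventually (u := u) (M := max M n)
    (C := C * ‖f (n + 1) / (ρ * c)‖) (fun i hi => by
      rw [hge i ((le_max_right _ _).trans hi), norm_mul]
      gcongr
      exact hC i ((le_max_left _ _).trans hi))
  have := eq_zero_of_bounded_backward hρ hnonneg hθ (u := fun i => R i - u i) (C := C' + B)
    (fun i => (norm_sub_le _ _).trans (add_le_add (hR i) (hB i)))
    (fun i => by linear_combination hRn i - hu i) i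
  exact sub_eq_zero.1 this

end green

/-! ### Erlang weights and boundedness of the weighted `H`. -/

section erlang

variable {ρ η : ℝ} {m : ℕ} {θ : ℂ}

/-- Above `m` the death rate in state `n + 1` is `η(n - m + 1 + m/η)`, so the product of rates
telescopes into a Gamma quotient. -/
lemma invWeight_erlang (hρ : 0 < ρ) (hη : 0 < η) {n : ℕ} (hn : m ≤ n) :
    (invWeight ρ (erlangDeathRate m η) n : ℂ) = invWeight ρ (erlangDeathRate m η) m *
      (((ρ / η : ℝ) : ℂ) ^ ((m : ℤ) - (n : ℤ)) *
        (Complex.Gamma ((n : ℂ) - m + 1 + m / η) / Complex.Gamma (1 + m / η))) := by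
  have hρ0 : (ρ : ℂ) ≠ 0 := by exact_mod_cast hρ.ne'
  have hη0 : (η : ℂ) ≠ 0 := by exact_mod_cast hη.ne'
  have hpos : 0 ≤ (m : ℝ) / η := by positivity
  have hG : Complex.Gamma (1 + m / η) ≠ 0 := by
    refine Complex.Gamma_ne_zero_of_re_pos ?_
    have : (1 + m / η : ℂ) = ((1 + m / η : ℝ) : ℂ) := by push_cast; rfl
    rw [this, Complex.ofReal_re]
    linarith
  induction n, hn using Nat.le_induction with
  | base => simp [hG]
  | succ n hn ih =>
    refine mul_left_cancel₀ hρ0 ?_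
    have hs : (n : ℂ) - m + 1 + m / η ≠ 0 := by
      have hmn : (m : ℝ) ≤ n := by exact_mod_cast hn
      have : (n : ℂ) - m + 1 + m / η = ((n - m + 1 + m / η : ℝ) : ℂ) := by push_cast; rfl
      rw [this]
      exact_mod_cast (by linarith : (n : ℝ) - m + 1 + m / η ≠ 0)
    have hκ0 : ((ρ / η : ℝ) : ℂ) ≠ 0 := by
      push_cast
      exact div_ne_zero hρ0 hη0
    rw [invWeight_succ hρ, ih, erlangDeathRate_of_le (by omega : m ≤ n + 1)]
    have e1 : ((n + 1 : ℕ) : ℂ) - m + 1 + m / η = ((n : ℂ) - m + 1 + m / η) + 1 := by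
      push_cast
      ring
    have e2 : (m : ℤ) - ((n + 1 : ℕ) : ℤ) = ((m : ℤ) - (n : ℤ)) - 1 := by
      push_cast
      ring
    rw [e1, Complex.Gamma_add_one _ hs, e2, zpow_sub_one₀ hκ0]
    generalize Complex.Gamma ((n : ℂ) - m + 1 + m / η) = G
    generalize ((ρ / η : ℝ) : ℂ) ^ ((m : ℤ) - (n : ℤ)) = K
    push_cast
    field_simp
    ring

lemma exists_norm_invWeight_mul_erlangH_le (hρ : 0 < ρ) (hη : 0 < η) (hθ : 0 < θ.re) :
    ∃ C : ℝ, ∀ n : ℕ, m + 1 ≤ n →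
      ‖invWeight ρ (erlangDeathRate m η) n * erlangH ρ η m θ n‖ ≤ C := by
  obtain ⟨C, hC⟩ := exists_norm_loopTransform_le (div_pos hρ hη) (re_div_pos hη hθ)
  have hκ0 : ((ρ / η : ℝ) : ℂ) ≠ 0 := by
    exact_mod_cast (div_pos hρ hη).ne'
  refine ⟨‖(invWeight ρ (erlangDeathRate m η) m : ℂ) *
    (((ρ / η : ℝ) : ℂ) ^ (1 + m / η : ℂ) / Complex.Gamma (1 + m / η))‖ * C, fun n hn => ?_⟩
  have hmn : (m : ℝ) + 1 ≤ n := by exact_mod_cast hn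
  -- The range `n ≥ m + 1` is what makes the bound for `s ≥ 2` available.
  have hs : (2 : ℝ) ≤ n + 1 - m + m / η := by
    have : 0 ≤ (m : ℝ) / η := by positivity
    linarith
  have h := hC _ hs
  have e : (invWeight ρ (erlangDeathRate m η) n : ℂ) * erlangH ρ η m θ n =
      ((invWeight ρ (erlangDeathRate m η) m : ℂ) *
        (((ρ / η : ℝ) : ℂ) ^ (1 + m / η : ℂ) / Complex.Gamma (1 + m / η))) *
      (Complex.Gamma ((n + 1 - m + m / η : ℝ) : ℂ) *
        ((ρ / η : ℝ) : ℂ) ^ (-((n + 1 - m + m / η : ℝ) : ℂ)) *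
        loopTransform (ρ / η) (θ / η) 1 2 (n + 1 - m + m / η)) := by
    have e1 : ((ρ / η : ℝ) : ℂ) ^ ((m : ℤ) - (n : ℤ)) = ((ρ / η : ℝ) : ℂ) ^ (1 + m / η : ℂ) *
        ((ρ / η : ℝ) : ℂ) ^ (-((n + 1 - m + m / η : ℝ) : ℂ)) := by
      rw [← Complex.cpow_add _ _ hκ0, ← Complex.cpow_intCast]
      congr 1
      push_cast
      ring
    have e2 : (n : ℂ) - m + 1 + m / η = ((n + 1 - m + m / η : ℝ) : ℂ) := by
      push_cast
      ring
    rw [invWeight_erlang hρ hη (by omega), erlangH_eq, e1, e2]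
    push_cast
    ring
  rw [e, norm_mul]
  gcongr

end erlang

/-! ### Assembly of the Green function. -/

theorem theorem2 {Ω : Type*} [MeasurableSpace Ω] (μ : Measure Ω) [IsProbabilityMeasure μ]
    (N : ℝ → Ω → ℕ) (m : ℕ) (ρ η : ℝ) (hρ : 0 < ρ) (hη : 0 < η)
    (hN : IsBirthDeathProcess (fun _ => ρ) (erlangDeathRate m η) μ N)
    (n₀ : ℕ) (hn₀ : m ≤ n₀) (hinit : μ (N 0 ⁻¹' {n₀}) ≠ 0)
    (θ : ℂ) (hθ : 0 < θ.re) :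
    erlangD ρ η m θ ≠ 0 ∧
    (∀ n : ℕ, IntegrableOn
      (fun t : ℝ => Complex.exp (-θ * t) * (transientProb μ N n₀ n t : ℂ)) (Set.Ioi 0)) ∧
    (∀ n : ℕ, n₀ ≤ n →
      laplaceTransform (transientProb μ N n₀ n) θ =
        1 / ρ * Complex.exp (-ρ / η)
          * ((η / ρ : ℝ) : ℂ) ^ ((n₀ : ℂ) - m - 1 + (θ + m) / η)
          * Complex.Gamma (θ / η) * Complex.Gamma ((n₀ : ℂ) - m + 1 + m / η)
          * (erlangI ρ η m θ n₀
              + (erlangI ρ η m θ m * erlangF ρ θ (m - 1)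
                  - erlangI ρ η m θ (m - 1) * erlangF ρ θ m) / erlangD ρ η m θ
                * erlangH ρ η m θ n₀)
          * erlangH ρ η m θ n) ∧
    (∀ n : ℕ, m ≤ n → n ≤ n₀ →
      laplaceTransform (transientProb μ N n₀ n) θ =
        1 / ρ * Complex.exp (-ρ / η)
          * ((η / ρ : ℝ) : ℂ) ^ ((n₀ : ℂ) - m - 1 + (θ + m) / η)
          * Complex.Gamma (θ / η) * Complex.Gamma ((n₀ : ℂ) - m + 1 + m / η)
          * (erlangI ρ η m θ n
              + (erlangI ρ η m θ m * erlangF ρ θ (m - 1)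
                  - erlangI ρ η m θ (m - 1) * erlangF ρ θ m) / erlangD ρ η m θ
                * erlangH ρ η m θ n)
          * erlangH ρ η m θ n₀) ∧
    (∀ n : ℕ, n ≤ m →
      laplaceTransform (transientProb μ N n₀ n) θ =
        1 / ρ * ((ρ / η : ℝ) : ℂ) ^ ((m : ℤ) - (n₀ : ℤ))
          * (Complex.Gamma ((n₀ : ℂ) - m + 1 + m / η) / Complex.Gamma (1 + m / η))
          * (erlangH ρ η m θ n₀ * erlangF ρ θ n / erlangD ρ η m θ)) := by
  obtain ⟨P, hP, hmarkov⟩ := hN.markov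
  have hmu0 : erlangDeathRate m η 0 = 0 := by simp [erlangDeathRate]
  have hmu := erlangDeathRate_pos (m := m) hη
  have hp : ∀ n t, 0 ≤ t → transientProb μ N n₀ n t = P t n₀ n := fun n t ht =>
    transientProb_eq (hN.measurable 0 le_rfl) hmarkov hinit n ht
  have hlap : ∀ n, laplaceTransform (transientProb μ N n₀ n) θ =
      laplaceTransform (fun t => P t n₀ n) θ := fun n =>
    setIntegral_congr_fun measurableSet_Ioi fun t ht => by simp only [hp n t (Set.mem_Ioi.1 ht).le]
  have hρ0 : (ρ : ℂ) ≠ 0 := by exact_mod_cast hρ.ne'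
  have hη0 : (η : ℂ) ≠ 0 := by exact_mod_cast hη.ne'
  -- The shift by one makes room for the index `-1`, which becomes `0`.
  set hF : ℕ → ℂ := fun i => erlangF ρ θ ((i : ℤ) - 1) with hF_def
  set hH : ℕ → ℂ := fun i => erlangH ρ η m θ ((i : ℤ) - 1) with hH_def
  set hI : ℕ → ℂ := fun i => erlangI ρ η m θ ((i : ℤ) - 1) with hI_def
  have sH : ∀ n : ℕ, hH (n + 1) = erlangH ρ η m θ n := fun n => by simp [hH_def]
  have sI : ∀ n : ℕ, hI (n + 1) = erlangI ρ η m θ n := fun n => by simp [hI_def]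
  have sF : ∀ n : ℕ, hF (n + 1) = erlangF ρ θ n := fun n => by simp [hF_def]
  have rH : ∀ n, m ≤ n → IsForwardAt ρ (erlangDeathRate m η) θ hH n := fun n hn => by
    rw [IsForwardAt, sH, sH]
    exact erlangH_recursion hρ hη hθ hn
  have rI : ∀ n, m ≤ n → IsForwardAt ρ (erlangDeathRate m η) θ hI n := fun n hn => by
    rw [IsForwardAt, sI, sI]
    exact erlangI_recursion hρ hη hθ hn
  have rF : ∀ n, n < m → IsForwardAt ρ (erlangDeathRate m η) θ hF n := fun n hn => by
    rw [IsForwardAt, sF, sF, erlangDeathRate, erlangDeathRate, if_pos hn.le, if_pos (by omega)]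
    simpa using erlangF_recursion ρ θ n
  have wIH : ∀ n, m ≤ n → hI (n + 1) * hH n - hH (n + 1) * hI n =
      Complex.exp (ρ / η) * ((ρ / η : ℝ) : ℂ) ^ ((n : ℂ) - m - 1 + (θ + m) / η) /
        (Complex.Gamma (θ / η) * Complex.Gamma ((n : ℂ) - m + 1 + m / η)) := fun n hn => by
    rw [sH, sI]
    exact erlang_wronskian hρ hη hθ hn
  have hκ0 : ((ρ / η : ℝ) : ℂ) ≠ 0 := by exact_mod_cast (div_pos hρ hη).ne'
  have hΓθ : Complex.Gamma (θ / η) ≠ 0 := Complex.Gamma_ne_zero_of_re_pos (re_div_pos hη hθ)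
  have hΓ : ∀ n : ℕ, m ≤ n → Complex.Gamma ((n : ℂ) - m + 1 + m / η) ≠ 0 := fun n hn => by
    have hmn : (m : ℝ) ≤ n := by exact_mod_cast hn
    have e : (n : ℂ) - m + 1 + m / η = ((n - m + 1 + m / η : ℝ) : ℂ) := by push_cast; rfl
    have : 0 ≤ (m : ℝ) / η := by positivity
    rw [e]
    exact Complex.Gamma_ne_zero_of_re_pos (by rw [Complex.ofReal_re]; linarith)
  have wIH0 : ∀ n, m ≤ n → hI (n + 1) * hH n - hH (n + 1) * hI n ≠ 0 := fun n hn => by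
    rw [wIH n hn]
    exact div_ne_zero (mul_ne_zero (Complex.exp_ne_zero _)
      fun h => hκ0 ((Complex.cpow_eq_zero_iff _ _).1 h).1)
      (mul_ne_zero hΓθ (hΓ n hn))
  set W : ℂ := hI (m + 1) * hH m - hH (m + 1) * hI m
  have hW : W ≠ 0 := wIH0 m le_rfl
  set D : ℂ := hF (m + 1) * hH m - hH (m + 1) * hF m with hD_def
  set b : ℂ := hI (m + 1) * hF m - hI m * hF (m + 1) with hb_def
  have hDe : erlangD ρ η m θ = D := by rw [hD_def, sF, sH]; rfl
  have hbe : erlangI ρ η m θ m * erlangF ρ θ (m - 1) - erlangI ρ η m θ (m - 1) * erlangF ρ θ m = b := by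
    rw [hb_def, sI, sF]
  -- By Cramer's rule `D / W` and `b / W` make the combination of `I` and `H` agree with `hF` at
  -- both `m` and `m + 1`. The two pieces thus overlap at two consecutive indices, enough for a
  -- second-order recursion to hold across the junction.
  set L : ℕ → ℂ := fun i => if i ≤ m then hF i else (D * hI i + b * hH i) / W with hL_def
  have hLle : ∀ i, i ≤ m + 1 → L i = hF i := by
    intro i hi
    rcases hi.lt_or_eq with h | rfl
    · simp [hL_def, Nat.le_of_lt_succ h]
    · simp only [hL_def, if_neg (by omega : ¬ m + 1 ≤ m)]
      rw [div_eq_iff hW]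
      simp only [hD_def, hb_def, W]
      ring
  have hLge : ∀ i, m ≤ i → L i = (D * hI i + b * hH i) / W := by
    intro i hi
    rcases hi.lt_or_eq with h | rfl
    · simp [hL_def, not_le.2 h]
    · rw [hLle m (by omega), eq_div_iff hW]
      simp only [hD_def, hb_def, W]
      ring
  have rL : ∀ n, IsForwardAt ρ (erlangDeathRate m η) θ L n := by
    intro n
    rcases lt_or_ge n m with h | h
    · rw [IsForwardAt, hLle n (by omega), hLle (n + 1) (by omega), hLle (n + 2) (by omega)]
      exact rF n h
    · have h1 := rH n h
      have h2 := rI n h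
      rw [IsForwardAt] at h1 h2 ⊢
      rw [hLge n h, hLge (n + 1) (by omega), hLge (n + 2) (by omega)]
      linear_combination D / W * h2 + b / W * h1
  have hL0 : L 0 = 0 := by
    rw [hLle 0 (by omega)]
    simpa [hF_def] using erlangF_neg_one ρ θ
  have hL1 : L 1 = 1 := by
    rw [hLle 1 (by omega), sF 0]
    exact erlangF_zero ρ θ
  obtain ⟨G, rG, hG⟩ := exists_forward_extension hρ m hH rH
  obtain ⟨C, hC⟩ := exists_norm_invWeight_mul_erlangH_le (m := m) hρ hη hθ
  have hC' : ∀ n, m + 1 ≤ n → ‖invWeight ρ (erlangDeathRate m η) n * G (n + 1)‖ ≤ C := by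
    intro n hn
    rw [hG (n + 1) (by omega), sH]
    exact hC n hn
  have hwr := invWeight_mul_wronskian hρ rL rG
  have hwD : L 1 * G 0 - G 1 * L 0 = invWeight ρ (erlangDeathRate m η) m * D := by
    rw [← hwr m, hLle m (by omega), hLle (m + 1) le_rfl, hG m le_rfl, hG (m + 1) (by omega)]
  have hw0 : ∀ n, (invWeight ρ (erlangDeathRate m η) n : ℂ) ≠ 0 := fun n => by
    exact_mod_cast (Finset.prod_pos fun k _ => div_pos (hmu k) hρ).ne'
  -- Since `L 0 = 0` and `L 1 = 1`, `hwD` says that `G 0` is a nonzero multiple of `D`. If it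
  -- vanished, `G` would be a bounded solution with the right boundary value, hence zero.
  have hD : D ≠ 0 := by
    intro h0
    rw [h0, hL0, hL1] at hwD
    obtain ⟨B, hB⟩ := exists_bound_of_eventually hC'
    have hz := forward_eq_zero_of_bounded hρ hmu0 hmu hθ rG (by simpa using hwD) hB
    -- With `m + 1` both indices of `G` in the determinant are positive, as `hz` requires.
    refine wIH0 (m + 1) (by omega) ?_
    rw [← hG (m + 1) (by omega), ← hG (m + 1 + 1) (by omega), hz, hz]
    simp
  have hgreen : ∀ n, laplaceTransform (transientProb μ N n₀ n) θ =
      invWeight ρ (erlangDeathRate m η) n₀ * L (min n₀ n + 1) * G (max n₀ n + 1) /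
        (ρ * (invWeight ρ (erlangDeathRate m η) m * D)) := by
    intro n
    rw [hlap]
    exact eq_green_of_bounded hρ hmu0 hmu hθ rL hL0 rG hC' (mul_ne_zero (hw0 m) hD)
      (fun n => (hwr n).trans hwD) n (R := fun i => laplaceTransform (fun t => P t i n) θ)
      (fun i => hP.norm_laplaceTransform_le i n hθ)
      (fun i => hP.laplaceTransform_backward hmu0 i n hθ) n₀
  -- The stated prefactor is the weight quotient divided by `W`: the powers of `ρ/η` with exponent
  -- depending on `θ` cancel against those in `W`.
  have hconst : Complex.exp (-ρ / η) * ((η / ρ : ℝ) : ℂ) ^ ((n₀ : ℂ) - m - 1 + (θ + m) / η) *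
      Complex.Gamma (θ / η) * W = ((ρ / η : ℝ) : ℂ) ^ ((m : ℤ) - (n₀ : ℤ)) /
        Complex.Gamma (1 + m / η) := by
    have hW' := wIH m le_rfl
    rw [show hI (m + 1) * hH m - hH (m + 1) * hI m = W from rfl, sub_self, zero_sub, zero_add] at hW'
    have e1 : ((η / ρ : ℝ) : ℂ) ^ ((n₀ : ℂ) - m - 1 + (θ + m) / η) =
        ((ρ / η : ℝ) : ℂ) ^ (-((n₀ : ℂ) - m - 1 + (θ + m) / η)) := by
      rw [← inv_div ρ η, Complex.ofReal_inv, Complex.inv_cpow _ _ (by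
        rw [Complex.arg_ofReal_of_nonneg (div_pos hρ hη).le]; exact Real.pi_pos.ne),
        Complex.cpow_neg]
    have e2 : ((ρ / η : ℝ) : ℂ) ^ ((m : ℤ) - (n₀ : ℤ)) =
        ((ρ / η : ℝ) : ℂ) ^ (-((n₀ : ℂ) - m - 1 + (θ + m) / η)) *
          ((ρ / η : ℝ) : ℂ) ^ (-1 + (θ + m) / η) := by
      rw [← Complex.cpow_add _ _ hκ0, ← Complex.cpow_intCast]
      congr 1
      push_cast
      ring
    have e3 : Complex.exp (-ρ / η) * Complex.exp (ρ / η) = 1 := by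
      rw [← Complex.exp_add]
      simp [neg_div]
    have hΓm := hΓ m le_rfl
    rw [sub_self, zero_add] at hΓm
    rw [hW', e1, e2]
    have e4 : ∀ X Y E₁ E₂ : ℂ, E₁ * X * Complex.Gamma (θ / η) *
        (E₂ * Y / (Complex.Gamma (θ / η) * Complex.Gamma (1 + m / η))) =
          (E₁ * E₂) * (X * Y / Complex.Gamma (1 + m / η)) := fun X Y E₁ E₂ => by
      field_simp
    rw [e4, e3, one_mul]
  have hfin : ∀ A x y z : ℂ, invWeight ρ (erlangDeathRate m η) m *
      (((ρ / η : ℝ) : ℂ) ^ ((m : ℤ) - (n₀ : ℤ)) * (A / Complex.Gamma (1 + m / η))) *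
        ((D * x + b * y) / W) * z / (ρ * (invWeight ρ (erlangDeathRate m η) m * D)) =
      1 / ρ * Complex.exp (-ρ / η) * ((η / ρ : ℝ) : ℂ) ^ ((n₀ : ℂ) - m - 1 + (θ + m) / η) *
        Complex.Gamma (θ / η) * A * (x + b / D * y) * z := fun A x y z => by
    have hwm := hw0 m
    have e1 : ∀ K Γ' : ℂ, invWeight ρ (erlangDeathRate m η) m * (K * (A / Γ')) *
        ((D * x + b * y) / W) * z / (ρ * (invWeight ρ (erlangDeathRate m η) m * D)) =
          K / Γ' * (1 / ρ * A * (x + b / D * y) * z / W) := fun K Γ' => by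
      field_simp
    rw [e1, ← hconst]
    generalize Complex.exp (-ρ / η) = E
    generalize ((η / ρ : ℝ) : ℂ) ^ ((n₀ : ℂ) - m - 1 + (θ + m) / η) = K
    field_simp
  refine ⟨hDe ▸ hD, fun n => ?_, fun n hn => ?_, fun n hmn hn => ?_, fun n hn => ?_⟩
  · refine (hP.integrableOn_exp_mul n₀ n hθ).congr_fun (fun t ht => ?_) measurableSet_Ioi
    simp only [hp n t (Set.mem_Ioi.1 ht).le]
  · rw [hgreen, min_eq_left hn, max_eq_right hn, hLge _ (by omega), hG _ (by omega),
      invWeight_erlang hρ hη hn₀, hDe, hbe, ← sH, ← sH, ← sI]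
    exact hfin _ _ _ _
  · rw [hgreen, min_eq_right hn, max_eq_left hn, hLge _ (by omega), hG _ (by omega),
      invWeight_erlang hρ hη hn₀, hDe, hbe, ← sH, ← sH, ← sI]
    exact hfin _ _ _ _
  · rw [hgreen, min_eq_right (hn.trans hn₀), max_eq_left (hn.trans hn₀), hLle _ (by omega),
      hG _ (by omega), invWeight_erlang hρ hη hn₀, hDe, ← sH, ← sF]
    have hwm := hw0 m
    field_simp
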